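/- Let $S\ge 0$ and $N\ge 1$ be integers, let $p_0,\dots,p_{S+1}$ be distinct points of $\mathbb{C}$, and let $B_0,\dots,B_{S+1}$ be complex $N\times N$ matrices. Put $$B(x)=\sum_{j=0}^{S+1}\frac{1}{x-p_j}B_j,\qquad Q(x)=\prod_{j=0}^{S+1}(x-p_j),\qquad B_\infty=\sum_{j=0}^{S+1}B_j,$$ and assume that $k+B_j$ (that is, $kI+B_j$) is invertible for all $k\in\mathbb{N}=\{0,1,2,\dots\}$ and all $j=0,1,\dots,S+1,\infty$. Let $D\subseteq\mathbb{C}$ be a simply connected domain containing $p_0,\dots,p_{S+1}$. Then for every function $\mathbf{g}:D\to\mathbb{C}^N$ analytic on $D$ there exists a unique polynomial $\boldsymbol{\phi}(x)$ with coefficients in $\mathbb{C}^N$, of degree at most $S$, such that the equation $$\mathbf{y}'(x)+B(x)\,\mathbf{y}(x)=\frac{1}{Q(x)}\bigl[\mathbf{g}(x)-\boldsymbol{\phi}(x)\bigr]$$ has a solution $\mathbf{y}(x)$ which is analytic on all of $D$, including at the points $p_0,\dots,p_{S+1}$ (the equation itself being required on $D\setminus\{p_0,\dots,p_{S+1}\}$).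 -/

import Mathlib

open Polynomial

noncomputable section

/-- The Fuchsian matrix `B(x) = ∑ j, (x - p j)⁻¹ • B j`. -/
def fuchsianMatrix {S N : ℕ} (p : Fin (S + 2) → ℂ)
    (B : Fin (S + 2) → Matrix (Fin N) (Fin N) ℂ) (x : ℂ) : Matrix (Fin N) (Fin N) ℂ :=
  ∑ j, (x - p j)⁻¹ • B j

/-- The polynomial function `Q(x) = ∏ j, (x - p j)`. -/
def fuchsianDenom {S : ℕ} (p : Fin (S + 2) → ℂ) (x : ℂ) : ℂ :=
  ∏ j, (x - p j)

/-- The value `φ(x)` of a vector polynomial `φ ∈ ℂ^N[x]`, given by its components. -/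
def vecPolyEval {N : ℕ} (φ : Fin N → ℂ[X]) (x : ℂ) : Fin N → ℂ :=
  fun i => (φ i).eval x

/-- `y` is an analytic solution on `D` of `y' + B(x) y = g(x) / Q(x)`: it is analytic at every
point of `D`, including the singular points, and it satisfies the equation at every point of `D`
where the coefficients of the equation are defined. -/
def IsAnalyticFuchsianSolution {S N : ℕ} (p : Fin (S + 2) → ℂ)
    (B : Fin (S + 2) → Matrix (Fin N) (Fin N) ℂ) (D : Set ℂ) (g y : ℂ → Fin N → ℂ) : Prop :=
  AnalyticOnNhd ℂ y D ∧
    ∀ x ∈ D, (∀ j, x ≠ p j) →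
      deriv y x + (fuchsianMatrix p B x).mulVec (y x) = (fuchsianDenom p x)⁻¹ • g x

end

/-! Write `L y = Q (y' + B y)`, an operator with polynomial coefficients (`fuchsianOp`). The claim
is that the analytic functions on `D` are the direct sum of the range of `L` and the polynomials of
degree at most `S`.

On polynomials this is division with remainder: the leading term of `L (x^d v)` is `x^(d+S+1) (d +
B_∞) v`, and `d + B_∞` is invertible (`exists_fuchsianOp_add_eq_of_mem_polyFun`,
`eq_zero_of_fuchsianOp_mem_polyFun`).

Uniqueness (`eq_zero_of_isSolOn_polyFun`): let `L y = φ` on `D` with `deg φ ≤ S`. All finite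
singular points lie in `D`, so `y` continues to an entire function. Infinity is a regular
singularity, so `y` grows polynomially by Gronwall and is a polynomial; its leading term then forces
`y = 0`, hence `φ = 0`. The continuation avoids paths and monodromy: a homeomorphism of the plane,
fixed off `D`, carries every `p j` into one disc inside `D`, and the preimage of that disc is
enlarged with its radius (`exists_isSolOn_univ`).

Existence: Runge's theorem (`exists_polynomial_near`, where simple connectedness enters)
approximates `g` by polynomials `G n`; divide, `G n = L (y n) + φ n`, and pass to the limit. If `L
(y n) → 0` locally uniformly then `y n → 0` (`tendstoLocallyUniformlyOn_zero_of_fuchsianOp`): near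
`p j` invertibility of `k + B j` controls the Taylor coefficients one at a time, and Gronwall
spreads the convergence over `D`. Hence `L` has closed range (`exists_fuchsianOp_eq_of_tendsto`).
The remainders cannot escape to infinity, since after rescaling their limit would be a nonzero
polynomial of low degree in the range, against uniqueness (`exists_isSolOn_sub_polyFun`). -/

section FuchsianSystems

open Filter Topology Metric Set

/-! ### Continuous dependence at a regular singular point. -/

section SingularPoint

variable {E : Type*} [NormedAddCommGroup E] [NormedSpace ℂ E]

/-- A priori bound at a regular singular point whose exponent dominates the coefficient. -/
theorem norm_le_of_euler_equation {r H M a : ℝ} {k : ℕ} (hk : 1 ≤ k)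
    {A : ℂ → E →L[ℂ] E} {u h : ℂ → E} (hu : DifferentiableOn ℂ u (ball 0 r))
    (hA : ∀ x ∈ ball (0 : ℂ) r, ‖A x‖ ≤ a)
    (hh : ∀ x ∈ ball (0 : ℂ) r, ‖h x‖ ≤ H)
    (heq : ∀ x ∈ ball (0 : ℂ) r, x • deriv u x + ((k : ℂ) • u x + A x (u x)) = h x)
    {x : ℂ} (hx : x ∈ ball (0 : ℂ) r) (hM : ∀ z : ℂ, ‖z‖ ≤ ‖x‖ → ‖u z‖ ≤ M) :
    ‖u x‖ ≤ (H + a * M) / k := by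
  have hk0 : (0 : ℝ) < k := by exact_mod_cast hk
  have hball : ∀ s ∈ Icc (0 : ℝ) 1, (s : ℂ) * x ∈ ball (0 : ℂ) r := by
    intro s hs
    rw [mem_ball_zero_iff] at hx ⊢
    calc ‖(s : ℂ) * x‖ = s * ‖x‖ := by rw [norm_mul, Complex.norm_real, Real.norm_of_nonneg hs.1]
      _ ≤ 1 * ‖x‖ := by gcongr; exact hs.2
      _ < r := by simpa using hx
  have hle : ∀ s ∈ Icc (0 : ℝ) 1, ‖(s : ℂ) * x‖ ≤ ‖x‖ := by
    intro s hs
    calc ‖(s : ℂ) * x‖ = s * ‖x‖ := by rw [norm_mul, Complex.norm_real, Real.norm_of_nonneg hs.1]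
      _ ≤ 1 * ‖x‖ := by gcongr; exact hs.2
      _ = ‖x‖ := one_mul _
  -- `s ^ k` is the integrating factor along the segment from `0` to `x`: it absorbs the term `k u`,
  -- leaving `F' = s^(k-1) (h - A u)`. Integrating `s^(k-1)` produces the gain `1 / k`.
  set F : ℝ → E := fun s => ((s : ℂ) ^ k) • u (s * x) with hF
  have hder : ∀ s ∈ Icc (0 : ℝ) 1, HasDerivAt F
      ((s : ℂ) ^ (k - 1) • (h (s * x) - A (s * x) (u (s * x)))) s := by
    intro s hs
    have h1 : HasDerivAt (fun z : ℂ => (z ^ k) • u (z * x))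
        ((s : ℂ) ^ k • (x • deriv u (s * x)) + ((k : ℂ) * (s : ℂ) ^ (k - 1)) • u (s * x)) (s : ℂ) := by
      have hd : HasDerivAt u (deriv u (s * x)) ((s : ℂ) * x) :=
        ((hu _ (hball s hs)).differentiableAt (isOpen_ball.mem_nhds (hball s hs))).hasDerivAt
      have hm : HasDerivAt (fun z : ℂ => z * x) x (s : ℂ) := by
        simpa using (hasDerivAt_id (s : ℂ)).mul_const x
      exact (hasDerivAt_pow k (s : ℂ)).smul (hd.scomp (s : ℂ) hm)
    have h2 := h1.scomp s Complex.ofRealCLM.hasDerivAt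
    refine HasDerivAt.congr_deriv (f := F) h2 ?_
    have e := heq _ (hball s hs)
    rw [← e, Complex.ofRealCLM_apply, Complex.ofReal_one, one_smul]
    obtain ⟨m, rfl⟩ : ∃ m, k = m + 1 := ⟨k - 1, by omega⟩
    simp only [Nat.add_sub_cancel, pow_succ, smul_add, smul_sub, smul_smul]
    module
  have hH0 : ∀ s ∈ Icc (0:ℝ) 1, ‖h (s * x) - A (s * x) (u (s * x))‖ ≤ H + a * M := by
    intro s hs
    refine (norm_sub_le _ _).trans (add_le_add (hh _ (hball s hs)) ?_)
    refine ((A _).le_opNorm _).trans ?_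
    exact mul_le_mul (hA _ (hball s hs)) (hM _ (hle s hs)) (norm_nonneg _)
      ((norm_nonneg _).trans (hA _ (hball s hs)))
  have key := image_norm_le_of_norm_deriv_right_le_deriv_boundary (f := F) (a := 0) (b := 1)
    (B := fun s => s ^ k * ((H + a * M) / k)) (B' := fun s => s ^ (k - 1) * (H + a * M))
    (f' := fun s => (s : ℂ) ^ (k - 1) • (h (s * x) - A (s * x) (u (s * x))))
    (fun s hs => (hder s hs).continuousAt.continuousWithinAt)
    (fun s hs => (hder s ⟨hs.1, hs.2.le⟩).hasDerivWithinAt)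
    (by simp [hF, zero_pow (by omega : k ≠ 0)])
    (fun s => by
      refine ((hasDerivAt_pow k s).mul_const ((H + a * M) / k)).congr_deriv ?_
      rw [mul_comm (k : ℝ), mul_assoc, mul_div_cancel₀ _ hk0.ne'])
    (fun s hs => by
      rw [norm_smul, norm_pow, Complex.norm_real, Real.norm_of_nonneg hs.1]
      exact mul_le_mul_of_nonneg_left (hH0 s ⟨hs.1, hs.2.le⟩) (pow_nonneg hs.1 _))
    (right_mem_Icc.2 zero_le_one)
  simpa [hF] using key

/-- Apply the a priori bound where `‖u‖` is maximal on the closed half disc: `k M ≤ H + a M`, and `a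
< k` lets the last term be absorbed. -/
theorem tendstoUniformlyOn_zero_of_euler_equation_of_lt [ProperSpace E] {ι : Type*} {l : Filter ι} {r a : ℝ}
    (hr : 0 < r) {k : ℕ} (hk : a < k) {A : ℂ → E →L[ℂ] E} {u h : ι → ℂ → E}
    (hA : ∀ x ∈ ball (0 : ℂ) r, ‖A x‖ ≤ a)
    (hu : ∀ n, DifferentiableOn ℂ (u n) (ball 0 r))
    (hh : TendstoUniformlyOn h 0 l (ball 0 r))
    (heq : ∀ n, ∀ x ∈ ball (0 : ℂ) r, x • deriv (u n) x + ((k : ℂ) • u n x + A x (u n x)) = h n x) :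
    TendstoUniformlyOn u 0 l (ball 0 (r / 2)) := by
  have ha : 0 ≤ a := (norm_nonneg _).trans (hA 0 (mem_ball_self hr))
  have hk0 : (0 : ℝ) < k := ha.trans_lt hk
  have hk1 : 1 ≤ k := by exact_mod_cast hk0
  rw [Metric.tendstoUniformlyOn_iff] at hh ⊢
  intro ε hε
  filter_upwards [hh (ε / 2 * (k - a)) (mul_pos (half_pos hε) (sub_pos.2 hk))] with n hn
  have hsub : closedBall (0 : ℂ) (r / 2) ⊆ ball 0 r := closedBall_subset_ball (half_lt_self hr)
  obtain ⟨x₀, hx₀, hmax⟩ := (isCompact_closedBall (0 : ℂ) (r / 2)).exists_isMaxOn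
    ⟨0, mem_closedBall_self (half_pos hr).le⟩ ((hu n).continuousOn.mono hsub).norm
  have hb := norm_le_of_euler_equation (H := ε / 2 * (k - a)) (M := ‖u n x₀‖) hk1 (hu n) hA
    (fun x hx => by simpa using (hn x hx).le) (heq n) (hsub hx₀)
    (fun z hz => hmax (by
      rw [mem_closedBall_zero_iff] at hx₀ ⊢; exact hz.trans hx₀))
  have hb' : ‖u n x₀‖ ≤ ε / 2 := by
    rw [le_div_iff₀ hk0] at hb
    have : ‖u n x₀‖ * (k - a) ≤ ε / 2 * (k - a) := by linarith
    exact le_of_mul_le_mul_right this (sub_pos.2 hk)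
  intro x hx
  have : ‖u n x‖ ≤ ‖u n x₀‖ := hmax (ball_subset_closedBall hx)
  simp only [Pi.zero_apply, dist_zero_left]
  linarith

/-- If `k + A 0` is invertible for every natural number `k`, then the analytic solutions of
`x u' + (k + A x) u = h` near `0` depend continuously on `h`. -/
theorem tendstoUniformlyOn_zero_of_euler_equation [FiniteDimensional ℂ E] {ι : Type*} {l : Filter ι}
    {r a : ℝ} (hr : 0 < r) {A : ℂ → E →L[ℂ] E} (hAd : DifferentiableOn ℂ A (ball 0 r))
    (hA : ∀ x ∈ ball (0 : ℂ) r, ‖A x‖ ≤ a)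
    (hinv : ∀ k : ℕ, Function.Injective fun v : E => (k : ℂ) • v + A 0 v)
    (k : ℕ) {u h : ι → ℂ → E}
    (hu : ∀ n, DifferentiableOn ℂ (u n) (ball 0 r))
    (hh : TendstoUniformlyOn h 0 l (ball 0 r))
    (heq : ∀ n, ∀ x ∈ ball (0 : ℂ) r, x • deriv (u n) x + ((k : ℂ) • u n x + A x (u n x)) = h n x) :
    TendstoUniformlyOn u 0 l (ball 0 (r / 2)) := by
  have : ProperSpace E := FiniteDimensional.proper ℂ E
  obtain ⟨K, hK⟩ := exists_nat_gt a
  -- Once `k` exceeds the bound `a` of the coefficient, the previous lemma applies. Below that,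
  -- splitting off the value at `0` and dividing by `x` raises `k` by one without changing `A`.
  induction hm : K - k generalizing k u h with
  | zero =>
    have : K ≤ k := by omega
    exact tendstoUniformlyOn_zero_of_euler_equation_of_lt hr
      (hK.trans_le (by exact_mod_cast this)) hA hu hh heq
  | succ m ih =>
    have h0 : (0 : ℂ) ∈ ball (0 : ℂ) r := mem_ball_self hr
    have hnhds : ball (0 : ℂ) r ∈ 𝓝 0 := isOpen_ball.mem_nhds h0
    -- the value at the origin tends to zero
    have hval : Tendsto (fun n => u n 0) l (𝓝 0) := by
      let T : E →ₗ[ℂ] E := (k : ℂ) • LinearMap.id + (A 0 : E →ₗ[ℂ] E)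
      have hT : Function.Injective T := hinv k
      obtain ⟨C, hC, hanti⟩ := (LinearMap.injective_iff_antilipschitz (f := T)).1 hT
      have hbound : ∀ n, ‖u n 0‖ ≤ C * ‖h n 0‖ := by
        intro n
        have := hanti.le_mul_dist (u n 0) 0
        have e := heq n 0 h0
        simp only [zero_smul, zero_add] at e
        rw [← e]
        simpa [T] using this
      have hh0 : Tendsto (fun n => h n 0) l (𝓝 0) := hh.tendsto_at h0
      refine squeeze_zero_norm hbound ?_
      simpa using hh0.norm.const_mul (C : ℝ)
    set w : ι → ℂ → E := fun n => dslope (u n) 0 with hw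
    have hwd : ∀ n, DifferentiableOn ℂ (w n) (ball 0 r) := fun n =>
      (Complex.differentiableOn_dslope hnhds).2 (hu n)
    have huw : ∀ n x, u n x = u n 0 + x • w n x := by
      intro n x
      have := sub_smul_dslope (u n) 0 x
      rw [sub_zero] at this
      rw [hw]; simp only [this]; abel
    set h₁ : ι → ℂ → E := fun n x => h n x - ((k : ℂ) • u n 0 + A x (u n 0)) with hh₁
    have hdu : ∀ n, ∀ x ∈ ball (0 : ℂ) r, deriv (u n) x = w n x + x • deriv (w n) x := by
      intro n x hx
      have hwx : HasDerivAt (w n) (deriv (w n) x) x :=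
        ((hwd n x hx).differentiableAt (isOpen_ball.mem_nhds hx)).hasDerivAt
      have : HasDerivAt (fun x => u n 0 + x • w n x) (x • deriv (w n) x + (1 : ℂ) • w n x) x :=
        ((hasDerivAt_id x).smul hwx).const_add _
      rw [show u n = fun x => u n 0 + x • w n x from funext (huw n), this.deriv]
      rw [one_smul, add_comm]
    have hx_eq : ∀ n, ∀ x ∈ ball (0 : ℂ) r,
        h₁ n x = x • (x • deriv (w n) x + (((k + 1 : ℕ) : ℂ) • w n x + A x (w n x))) := by
      intro n x hx
      rw [hh₁]
      simp only
      rw [← heq n x hx, hdu n x hx]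
      conv_lhs => rw [huw n x]
      simp only [map_add, map_smul, Nat.cast_add, Nat.cast_one]
      module
    set h₂ : ι → ℂ → E := fun n x => x • deriv (w n) x + (((k + 1 : ℕ) : ℂ) • w n x + A x (w n x))
      with hh₂
    have hh₂d : ∀ n, DifferentiableOn ℂ (h₂ n) (ball 0 r) := by
      intro n
      have := (hwd n).deriv isOpen_ball
      have h3 := hwd n
      exact (differentiableOn_id.smul this).add ((h3.const_smul _).add (hAd.clm_apply h3))
    have hh₁d : ∀ n, DifferentiableOn ℂ (h₁ n) (ball 0 r) := by
      intro n
      exact (differentiableOn_id.smul (hh₂d n)).congr (hx_eq n)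
    -- The new right-hand side is `h₁ / x`. Expressing it as a `dslope` makes the Schwarz lemma
    -- available, which bounds it on the whole disc of radius `r`; no radius is lost from one `k` to
    -- the next.
    have hdsl : ∀ n, ∀ x ∈ ball (0 : ℂ) r, dslope (h₁ n) 0 x = h₂ n x := by
      intro n
      have hcont : ContinuousOn (dslope (h₁ n) 0) (ball 0 r) :=
        ((Complex.differentiableOn_dslope hnhds).2 (hh₁d n)).continuousOn
      have hne : ∀ x ∈ ball (0 : ℂ) r, x ≠ 0 → dslope (h₁ n) 0 x = h₂ n x := by
        intro x hx hx0
        have h5 := sub_smul_dslope (h₁ n) 0 x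
        have h6 : h₁ n 0 = 0 := by simpa using hx_eq n 0 h0
        rw [h6, sub_zero, sub_zero, hx_eq n x hx] at h5
        exact smul_right_injective E hx0 h5
      intro x hx
      by_cases hx0 : x = 0
      · subst hx0
        have t1 : Tendsto (dslope (h₁ n) 0) (𝓝[≠] 0) (𝓝 (dslope (h₁ n) 0 0)) :=
          ((hcont.continuousAt hnhds).tendsto).mono_left nhdsWithin_le_nhds
        have t2 : Tendsto (h₂ n) (𝓝[≠] 0) (𝓝 (h₂ n 0)) :=
          (((hh₂d n).continuousOn.continuousAt hnhds).tendsto).mono_left nhdsWithin_le_nhds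
        refine tendsto_nhds_unique_of_eventuallyEq t1 t2 ?_
        filter_upwards [self_mem_nhdsWithin, mem_nhdsWithin_of_mem_nhds hnhds] with x hx hxb
        exact hne x hxb hx
      · exact hne x hx hx0
    have hh₂lim : TendstoUniformlyOn h₂ 0 l (ball 0 r) := by
      rw [Metric.tendstoUniformlyOn_iff] at hh ⊢
      intro ε hε
      have ha0 : 0 ≤ a := (norm_nonneg _).trans (hA 0 h0)
      have hδ : 0 < ε * r / 8 := by positivity
      have hlim2 : Tendsto (fun n => (k + a) * ‖u n 0‖) l (𝓝 0) := by
        simpa using hval.norm.const_mul (k + a)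
      filter_upwards [hh _ hδ, hlim2.eventually (gt_mem_nhds hδ)] with n hn1 hn2 x hx
      have hb : ∀ z ∈ ball (0 : ℂ) r, ‖h₁ n z‖ ≤ ε * r / 4 := by
        intro z hz
        have e1 : ‖h n z‖ < ε * r / 8 := by simpa using hn1 z hz
        have e2 : ‖(k : ℂ) • u n 0 + A z (u n 0)‖ ≤ (k + a) * ‖u n 0‖ := by
          refine (norm_add_le _ _).trans ?_
          rw [norm_smul, Complex.norm_natCast, add_mul]
          gcongr
          exact (A z).le_of_opNorm_le (hA z hz) _
        calc ‖h₁ n z‖ ≤ ‖h n z‖ + ‖(k : ℂ) • u n 0 + A z (u n 0)‖ := norm_sub_le _ _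
          _ ≤ _ := by linarith
      have := Complex.norm_dslope_le_div_of_mapsTo_ball (R₂ := ε * r / 2) (hh₁d n) (fun z hz => by
        rw [mem_closedBall, dist_eq_norm]
        refine (norm_sub_le _ _).trans ?_
        have := hb z hz
        have := hb 0 h0
        linarith) hx
      rw [hdsl n x hx] at this
      simp only [Pi.zero_apply, dist_zero_left]
      refine this.trans_lt ?_
      rw [div_lt_iff₀ hr]
      nlinarith [mul_pos hε hr]
    have hwlim := ih (k + 1) hwd hh₂lim (fun n x _ => rfl) (by omega)
    rw [Metric.tendstoUniformlyOn_iff] at hwlim ⊢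
    intro ε hε
    have hr2 : 0 < ε / (2 * r) := by positivity
    filter_upwards [hwlim _ hr2, (tendsto_zero_iff_norm_tendsto_zero.1 hval).eventually
      (gt_mem_nhds (half_pos hε))] with n hn1 hn2 x hx
    simp only [Pi.zero_apply, dist_zero_left] at hn1 ⊢
    rw [huw n x]
    have hxr : ‖x‖ ≤ r := by
      rw [mem_ball_zero_iff] at hx; linarith
    calc ‖u n 0 + x • w n x‖ ≤ ‖u n 0‖ + ‖x‖ * ‖w n x‖ := by
          rw [← norm_smul]; exact norm_add_le _ _
      _ ≤ ‖u n 0‖ + r * (ε / (2 * r)) := by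
          gcongr
          exact (hn1 x hx).le
      _ < ε := by
          have : r * (ε / (2 * r)) = ε / 2 := by field_simp
          rw [this]; linarith

end SingularPoint

/-! ### The operator `Q y' + Q B y`: continuous dependence and closed range. -/

theorem exists_ball_avoiding {ι : Type*} [Finite ι] {p : ι → ℂ} {D : Set ℂ}
    (hD : IsOpen D) {c : ℂ} (hc : c ∈ D) (hcp : ∀ j, c ≠ p j) :
    ∃ r > 0, ∀ x ∈ closedBall c r, x ∈ D ∧ ∀ j, x ≠ p j := by
  have h : D ∩ {x | ∀ j, x ≠ p j} ∈ 𝓝 c := by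
    refine inter_mem (hD.mem_nhds hc) ?_
    exact eventually_all.2 fun j => eventually_ne_nhds (hcp j)
  obtain ⟨r, hr, hrU⟩ := nhds_basis_closedBall.mem_iff.1 h
  exact ⟨r, hr, fun x hx => hrU hx⟩

section FuchsianOperator

variable {ι E : Type*} [Fintype ι] [DecidableEq ι] [NormedAddCommGroup E] [NormedSpace ℂ E]

/-- The coefficient `∑ j, (∏ i ≠ j, (x - p i)) • b j` of `y` in the Fuchsian operator with cleared
denominators. -/
noncomputable def fuchsianCoeff (p : ι → ℂ) (b : ι → E →L[ℂ] E) (x : ℂ) : E →L[ℂ] E :=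
  ∑ j, (∏ i ∈ Finset.univ.erase j, (x - p i)) • b j

/-- The Fuchsian operator `y ↦ Q y' + Q B y` with cleared denominators. -/
noncomputable def fuchsianOp (p : ι → ℂ) (b : ι → E →L[ℂ] E) (y : ℂ → E) (x : ℂ) : E :=
  (∏ j, (x - p j)) • deriv y x + fuchsianCoeff p b x (y x)

variable {p : ι → ℂ} {b : ι → E →L[ℂ] E}

theorem differentiable_fuchsianCoeff : Differentiable ℂ (fuchsianCoeff p b) := by
  unfold fuchsianCoeff
  fun_prop

theorem fuchsianCoeff_self (j : ι) :
    fuchsianCoeff p b (p j) = (∏ i ∈ Finset.univ.erase j, (p j - p i)) • b j := by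
  unfold fuchsianCoeff
  refine Finset.sum_eq_single j (fun k _ hk => ?_) (by simp)
  rw [Finset.prod_eq_zero (i := j) (by simp [hk.symm]) (sub_self _), zero_smul]

theorem fuchsianOp_sub {y z : ℂ → E} {x : ℂ} (hy : DifferentiableAt ℂ y x)
    (hz : DifferentiableAt ℂ z x) :
    fuchsianOp p b (fun t => y t - z t) x = fuchsianOp p b y x - fuchsianOp p b z x := by
  unfold fuchsianOp
  rw [deriv_fun_sub hy hz, map_sub]
  module

theorem fuchsianOp_add {y z : ℂ → E} {x : ℂ} (hy : DifferentiableAt ℂ y x)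
    (hz : DifferentiableAt ℂ z x) :
    fuchsianOp p b (fun t => y t + z t) x = fuchsianOp p b y x + fuchsianOp p b z x := by
  unfold fuchsianOp
  rw [deriv_fun_add hy hz, map_add]
  module

theorem fuchsianOp_const_smul (c : ℂ) {y : ℂ → E} {x : ℂ} (hy : DifferentiableAt ℂ y x) :
    fuchsianOp p b (fun t => c • y t) x = c • fuchsianOp p b y x := by
  unfold fuchsianOp
  rw [deriv_fun_const_smul c hy, map_smul]
  module

theorem fuchsianOp_congr {y z : ℂ → E} {x : ℂ} (h : y =ᶠ[𝓝 x] z) :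
    fuchsianOp p b y x = fuchsianOp p b z x := by
  unfold fuchsianOp
  rw [h.deriv_eq, h.eq_of_nhds]

theorem differentiableOn_fuchsianOp [CompleteSpace E] {D : Set ℂ} (hD : IsOpen D) {y : ℂ → E}
    (hy : DifferentiableOn ℂ y D) : DifferentiableOn ℂ (fuchsianOp p b y) D := by
  have h1 : Differentiable ℂ fun x : ℂ => ∏ j, (x - p j) := by fun_prop
  exact (h1.differentiableOn.smul (hy.deriv hD)).add
    (differentiable_fuchsianCoeff.differentiableOn.clm_apply hy)

/-- Away from the singular points, the equation can be solved for the derivative. -/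
theorem deriv_eq_of_fuchsianOp {y : ℂ → E} {x : ℂ} (hx : ∀ j, x ≠ p j) :
    deriv y x = (∏ j, (x - p j))⁻¹ • (fuchsianOp p b y x - fuchsianCoeff p b x (y x)) := by
  have : (∏ j, (x - p j)) ≠ 0 := Finset.prod_ne_zero_iff.2 fun j _ => sub_ne_zero.2 (hx j)
  rw [fuchsianOp, add_sub_cancel_right, inv_smul_smul₀ this]

/-- Dividing by `q = Q / (x - p j)`, which does not vanish near `p j`, and translating `p j` to `0`
gives an Euler equation with `k = 0` whose coefficient at the origin is the residue `b j`. -/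
theorem tendstoUniformlyOn_zero_near_singular [FiniteDimensional ℂ E] (hp : Function.Injective p)
    (j : ι) (hinv : ∀ k : ℕ, Function.Injective fun v : E => (k : ℂ) • v + b j v)
    {D : Set ℂ} (hD : IsOpen D) (hpD : p j ∈ D) {κ : Type*} {l : Filter κ} {y : κ → ℂ → E}
    (hy : ∀ n, DifferentiableOn ℂ (y n) D)
    (hlim : TendstoLocallyUniformlyOn (fun n => fuchsianOp p b (y n)) 0 l D) :
    ∃ U ∈ 𝓝 (p j), TendstoUniformlyOn y 0 l U := by
  set q : ℂ → ℂ := fun x => ∏ i ∈ Finset.univ.erase j, (x - p i) with hq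
  have hqd : Differentiable ℂ q := by rw [hq]; fun_prop
  have hq0 : q (p j) ≠ 0 := Finset.prod_ne_zero_iff.2 fun i hi =>
    sub_ne_zero.2 (hp.ne (Finset.ne_of_mem_erase hi).symm)
  have hprod : ∀ x, (∏ i, (x - p i)) = (x - p j) * q x := fun x =>
    (Finset.mul_prod_erase Finset.univ (fun i => x - p i) (Finset.mem_univ j)).symm
  have hU : D ∩ {x | q x ≠ 0} ∈ 𝓝 (p j) :=
    inter_mem (hD.mem_nhds hpD) (hqd.continuous.continuousAt.eventually_ne hq0)
  obtain ⟨r, hr, hrU⟩ := nhds_basis_closedBall.mem_iff.1 hU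
  have hmem : ∀ z ∈ closedBall (0 : ℂ) r, p j + z ∈ D ∩ {x | q x ≠ 0} := fun z hz =>
    hrU (by simpa using hz)
  have hbc : ball (0 : ℂ) r ⊆ closedBall 0 r := ball_subset_closedBall
  set A : ℂ → E →L[ℂ] E := fun z => (q (p j + z))⁻¹ • fuchsianCoeff p b (p j + z) with hA
  have hAd : ContinuousOn A (closedBall 0 r) := by
    have h1 : ContinuousOn (fun z => (q (p j + z))⁻¹) (closedBall (0 : ℂ) r) :=
      ContinuousOn.inv₀ (hqd.continuous.comp (by fun_prop)).continuousOn fun z hz => (hmem z hz).2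
    exact h1.smul ((differentiable_fuchsianCoeff (p := p) (b := b)).continuous.comp
      (by fun_prop : Continuous fun z : ℂ => p j + z)).continuousOn
  have hAd' : DifferentiableOn ℂ A (ball 0 r) := by
    have h1 : DifferentiableOn ℂ (fun z => (q (p j + z))⁻¹) (ball (0 : ℂ) r) :=
      DifferentiableOn.inv (hqd.comp (by fun_prop)).differentiableOn
        fun z hz => (hmem z (hbc hz)).2
    exact h1.smul ((differentiable_fuchsianCoeff (p := p) (b := b)).comp
      (by fun_prop : Differentiable ℂ fun z : ℂ => p j + z)).differentiableOn
  have hA0 : A 0 = b j := by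
    simp only [hA, add_zero, fuchsianCoeff_self]
    exact inv_smul_smul₀ hq0 _
  obtain ⟨a, ha⟩ := (isCompact_closedBall (0 : ℂ) r).exists_bound_of_continuousOn hAd
  have hcont : ContinuousOn (fun x => (q x)⁻¹) (closedBall (p j) r) :=
    hqd.continuous.continuousOn.inv₀ fun x hx => (hrU hx).2
  obtain ⟨C, hC⟩ := (isCompact_closedBall (p j) r).exists_bound_of_continuousOn hcont
  have hunif := (tendstoLocallyUniformlyOn_iff_forall_isCompact hD).1 hlim (closedBall (p j) r)
    (fun x hx => (hrU hx).1) (isCompact_closedBall _ _)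
  have key := tendstoUniformlyOn_zero_of_euler_equation (l := l) (A := A) (a := a) hr hAd'
    (fun x hx => ha x (hbc hx)) (by simpa only [hA0] using hinv) 0
    (u := fun n z => y n (p j + z))
    (h := fun n z => (q (p j + z))⁻¹ • fuchsianOp p b (y n) (p j + z))
    (fun n => (hy n).comp (by fun_prop) fun z hz => (hmem z (hbc hz)).1)
    (by
      rw [Metric.tendstoUniformlyOn_iff] at hunif ⊢
      intro ε hε
      have hC0 : 0 ≤ C := (norm_nonneg _).trans (hC _ (mem_closedBall_self hr.le))
      filter_upwards [hunif (ε / (C + 1)) (by positivity)] with n hn z hz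
      have hz' : p j + z ∈ closedBall (p j) r := by simpa using hbc hz
      have h1 := hn _ hz'
      simp only [Pi.zero_apply, dist_zero_left] at h1 ⊢
      rw [norm_smul]
      calc _ ≤ C * (ε / (C + 1)) := by
            gcongr
            exact hC _ hz'
        _ < ε := by
            rw [mul_div_assoc', div_lt_iff₀ (by positivity)]; nlinarith)
    (by
      intro n z hz
      have hqz : q (p j + z) ≠ 0 := (hmem z (hbc hz)).2
      simp only [CharP.cast_eq_zero, zero_smul, zero_add, hA, fuchsianOp, hprod,
        add_sub_cancel_left, _root_.smul_apply]
      rw [deriv_comp_const_add, smul_add, smul_smul]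
      congr 2
      field_simp)
  refine ⟨ball (p j) (r / 2), ball_mem_nhds _ (half_pos hr), ?_⟩
  rw [Metric.tendstoUniformlyOn_iff] at key ⊢
  intro ε hε
  filter_upwards [key ε hε] with n hn x hx
  simpa using hn (x - p j) (by simpa [dist_eq_norm] using hx)

/-- Gronwall's inequality along a segment in a disc. -/
theorem norm_le_gronwallBound_of_norm_deriv_le {c : ℂ} {r K ε : ℝ}
    {y : ℂ → E} (hy : DifferentiableOn ℂ y (ball c r))
    (hbound : ∀ x ∈ ball c r, ‖deriv y x‖ ≤ K * ‖y x‖ + ε)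
    {x₀ x : ℂ} (hx₀ : x₀ ∈ ball c r) (hx : x ∈ ball c r) :
    ‖y x‖ ≤ gronwallBound ‖y x₀‖ (2 * r * K) (2 * r * ε) 1 := by
  have hr : 0 < r := pos_of_mem_ball hx
  have hseg : ∀ t ∈ Icc (0 : ℝ) 1, x₀ + t * (x - x₀) ∈ ball c r := by
    intro t ht
    have := (convex_ball c r).add_smul_sub_mem hx₀ hx ht
    rwa [Complex.real_smul] at this
  have hn : ‖x - x₀‖ ≤ 2 * r := by
    rw [← dist_eq_norm]
    rw [mem_ball] at hx hx₀
    linarith [dist_triangle_right x x₀ c]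
  have hder : ∀ t ∈ Icc (0 : ℝ) 1, HasDerivAt (fun t : ℝ => y (x₀ + t * (x - x₀)))
      ((x - x₀) • deriv y (x₀ + t * (x - x₀))) t := by
    intro t ht
    have h1 : HasDerivAt y (deriv y (x₀ + t * (x - x₀))) (x₀ + t * (x - x₀)) :=
      ((hy _ (hseg t ht)).differentiableAt (isOpen_ball.mem_nhds (hseg t ht))).hasDerivAt
    have h2 : HasDerivAt (fun t : ℝ => x₀ + (t : ℂ) * (x - x₀)) (x - x₀) t := by
      simpa using (Complex.ofRealCLM.hasDerivAt (x := t)).mul_const (x - x₀) |>.const_add x₀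
    exact h1.scomp t h2
  have := norm_le_gronwallBound_of_norm_deriv_right_le (δ := ‖y x₀‖) (K := 2 * r * K)
    (ε := 2 * r * ε) (a := 0) (b := 1) (f := fun t : ℝ => y (x₀ + t * (x - x₀)))
    (fun t ht => (hder t ht).continuousAt.continuousWithinAt)
    (fun t ht => (hder t ⟨ht.1, ht.2.le⟩).hasDerivWithinAt) (by simp)
    (fun t ht => by
      have h1 := hbound _ (hseg t ⟨ht.1, ht.2.le⟩)
      rw [norm_smul]
      calc _ ≤ 2 * r * (K * ‖y (x₀ + t * (x - x₀))‖ + ε) := by gcongr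
        _ = _ := by ring) 1 (right_mem_Icc.2 zero_le_one)
  simpa using this

/-- Away from the singular points `y'` is bounded linearly by `y` and `L y`, so Gronwall carries
smallness at the single point `x₀` to the whole disc. -/
theorem tendstoUniformlyOn_zero_of_regular {D : Set ℂ} (hD : IsOpen D)
    {c : ℂ} {r : ℝ} (hr : 0 < r) (hball : ∀ x ∈ closedBall c r, x ∈ D ∧ ∀ j, x ≠ p j)
    {κ : Type*} {l : Filter κ} {y : κ → ℂ → E} (hy : ∀ n, DifferentiableOn ℂ (y n) D)
    (hlim : TendstoLocallyUniformlyOn (fun n => fuchsianOp p b (y n)) 0 l D)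
    {x₀ : ℂ} (hx₀ : x₀ ∈ ball c r) (h0 : Tendsto (fun n => y n x₀) l (𝓝 0)) :
    TendstoUniformlyOn y 0 l (ball c r) := by
  have hbc : ball c r ⊆ closedBall c r := ball_subset_closedBall
  set Q : ℂ → ℂ := fun x => ∏ j, (x - p j) with hQ
  have hQd : Differentiable ℂ Q := by rw [hQ]; fun_prop
  have hcont : ContinuousOn (fun x => (Q x)⁻¹) (closedBall c r) :=
    hQd.continuous.continuousOn.inv₀ fun x hx =>
      Finset.prod_ne_zero_iff.2 fun j _ => sub_ne_zero.2 ((hball x hx).2 j)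
  obtain ⟨C, hC⟩ := (isCompact_closedBall c r).exists_bound_of_continuousOn hcont
  obtain ⟨a, ha⟩ := (isCompact_closedBall c r).exists_bound_of_continuousOn
    (differentiable_fuchsianCoeff (p := p) (b := b)).continuous.continuousOn
  have hC0 : 0 ≤ C := (norm_nonneg _).trans (hC c (mem_closedBall_self hr.le))
  have hunif := (tendstoLocallyUniformlyOn_iff_forall_isCompact hD).1 hlim (closedBall c r)
    (fun x hx => (hball x hx).1) (isCompact_closedBall _ _)
  have hbound : ∀ n ε, (∀ x ∈ closedBall c r, ‖fuchsianOp p b (y n) x‖ ≤ ε) → ∀ x ∈ ball c r,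
      ‖y n x‖ ≤ gronwallBound ‖y n x₀‖ (2 * r * (C * a)) (2 * r * (C * ε)) 1 := by
    intro n ε hε x hx
    refine norm_le_gronwallBound_of_norm_deriv_le ((hy n).mono fun x hx => (hball x (hbc hx)).1)
      (fun z hz => ?_) hx₀ hx
    rw [deriv_eq_of_fuchsianOp (b := b) (hball z (hbc hz)).2, norm_smul]
    calc _ ≤ C * (ε + a * ‖y n z‖) := by
          gcongr
          · exact hC z (hbc hz)
          · refine (norm_sub_le _ _).trans (add_le_add (hε z (hbc hz)) ?_)
            exact (fuchsianCoeff p b z).le_of_opNorm_le (ha z (hbc hz)) _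
      _ = _ := by ring
  -- For a fixed rate the Gronwall bound is linear in the initial value and in the error; the zero
  -- rate has its own formula.
  obtain ⟨G, hG⟩ : ∃ G : ℝ, ∀ δ ε, gronwallBound δ (2 * r * (C * a)) ε 1 ≤
      δ * Real.exp (2 * r * (C * a)) + ε * G := by
    by_cases hK : 2 * r * (C * a) = 0
    · exact ⟨1, fun δ ε => by rw [hK, gronwallBound_K0]; simp⟩
    · refine ⟨(Real.exp (2 * r * (C * a)) - 1) / (2 * r * (C * a)), fun δ ε => ?_⟩
      rw [gronwallBound_of_K_ne_0 hK]
      refine le_of_eq ?_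
      simp only [mul_one]
      ring
  rw [Metric.tendstoUniformlyOn_iff] at hunif ⊢
  intro ε hε
  set η := ε / (4 * (2 * r * C * |G| + 1)) with hη
  have hη0 : 0 < η := by positivity
  have hlim0 : Tendsto (fun n => ‖y n x₀‖ * Real.exp (2 * r * (C * a))) l (𝓝 0) := by
    simpa using h0.norm.mul_const (Real.exp (2 * r * (C * a)))
  filter_upwards [hunif η hη0, hlim0.eventually (gt_mem_nhds (half_pos hε))] with n hn1 hn2 x hx
  have h1 := hbound n η (fun z hz => by simpa using (hn1 z hz).le) x hx
  simp only [Pi.zero_apply, dist_zero_left]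
  refine (h1.trans (hG _ _)).trans_lt ?_
  have h2 : 2 * r * (C * η) * G ≤ ε / 4 := by
    calc 2 * r * (C * η) * G ≤ 2 * r * (C * η) * |G| := by gcongr; exact le_abs_self G
      _ = (2 * r * C * |G|) * η := by ring
      _ ≤ (2 * r * C * |G| + 1) * η := by gcongr; linarith
      _ = ε / 4 := by rw [hη]; field_simp
  linarith

/-- On a connected domain containing a singular point with admissible exponents, a family of
analytic functions tends to zero as soon as its image under the Fuchsian operator does. -/
theorem tendstoLocallyUniformlyOn_zero_of_fuchsianOp [FiniteDimensional ℂ E]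
    (hp : Function.Injective p)
    (hinv : ∀ (k : ℕ) (j : ι), Function.Injective fun v : E => (k : ℂ) • v + b j v)
    [Nonempty ι] {D : Set ℂ} (hD : IsOpen D) (hDc : IsPreconnected D) (hpD : ∀ j, p j ∈ D)
    {κ : Type*} {l : Filter κ} {y : κ → ℂ → E} (hy : ∀ n, DifferentiableOn ℂ (y n) D)
    (hlim : TendstoLocallyUniformlyOn (fun n => fuchsianOp p b (y n)) 0 l D) :
    TendstoLocallyUniformlyOn y 0 l D := by
  set G : Set ℂ := {x | ∃ U ∈ 𝓝 x, TendstoUniformlyOn y 0 l U} with hG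
  have hpG : ∀ j, p j ∈ G := fun j =>
    tendstoUniformlyOn_zero_near_singular hp j (fun k => hinv k j) hD (hpD j) hy hlim
  have hGo : IsOpen G := by
    rw [isOpen_iff_mem_nhds]
    rintro x ⟨U, hU, hlimU⟩
    filter_upwards [eventually_mem_nhds_iff.2 hU] with z hz
    exact ⟨U, hz, hlimU⟩
  -- The set of good points is relatively closed: a regular limit point is the centre of a disc
  -- containing a good point, from which Gronwall reaches the centre, and singular points are always
  -- good.
  have hDG : D ⊆ G := by
    refine hDc.subset_of_closure_inter_subset hGo ?_ ?_
    · obtain ⟨j⟩ := ‹Nonempty ι›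
      exact ⟨p j, hpD j, hpG j⟩
    · rintro x ⟨hx, hxD⟩
      by_cases hxp : ∀ j, x ≠ p j
      · obtain ⟨r, hr, hball⟩ := exists_ball_avoiding hD hxD hxp
        obtain ⟨x₀, hx₀, U, hU, hlimU⟩ := Metric.mem_closure_iff.1 hx r hr |>.imp
          fun z hz => (⟨by rw [mem_ball, dist_comm]; exact hz.2, hz.1⟩ : z ∈ ball x r ∧ z ∈ G)
        exact ⟨ball x r, ball_mem_nhds x hr, tendstoUniformlyOn_zero_of_regular hD hr hball hy hlim
          hx₀ (hlimU.tendsto_at (mem_of_mem_nhds hU))⟩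
      · push Not at hxp
        obtain ⟨j, rfl⟩ := hxp
        exact hpG j
  rw [Metric.tendstoLocallyUniformlyOn_iff]
  intro ε hε x hx
  obtain ⟨U, hU, hlimU⟩ := hDG hx
  exact ⟨U, mem_nhdsWithin_of_mem_nhds hU, Metric.tendstoUniformlyOn_iff.1 hlimU ε hε⟩

/-- Weierstrass: locally uniform limits of analytic functions commute with differentiation. -/
theorem tendstoLocallyUniformlyOn_fuchsianOp [FiniteDimensional ℂ E] {D : Set ℂ} (hD : IsOpen D)
    {κ : Type*} {l : Filter κ} {y : κ → ℂ → E} {z : ℂ → E}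
    (hy : ∀ n, DifferentiableOn ℂ (y n) D) (hlim : TendstoLocallyUniformlyOn y z l D)
    {x : ℂ} (hx : x ∈ D) :
    Tendsto (fun n => fuchsianOp p b (y n) x) l (𝓝 (fuchsianOp p b z x)) := by
  have : CompleteSpace E := FiniteDimensional.complete ℂ E
  have h1 := (hlim.deriv (Eventually.of_forall hy) hD).tendsto_at hx
  have h2 := hlim.tendsto_at hx
  exact (h1.const_smul _).add (((fuchsianCoeff p b x).continuous.tendsto _).comp h2)

/-- The Fuchsian operator has closed range. -/
theorem exists_fuchsianOp_eq_of_tendsto [FiniteDimensional ℂ E] (hp : Function.Injective p)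
    (hinv : ∀ (k : ℕ) (j : ι), Function.Injective fun v : E => (k : ℂ) • v + b j v)
    [Nonempty ι] {D : Set ℂ} (hD : IsOpen D) (hDc : IsPreconnected D) (hpD : ∀ j, p j ∈ D)
    {y : ℕ → ℂ → E} {g : ℂ → E} (hy : ∀ n, DifferentiableOn ℂ (y n) D)
    (hlim : TendstoLocallyUniformlyOn (fun n => fuchsianOp p b (y n)) g atTop D) :
    ∃ z : ℂ → E, DifferentiableOn ℂ z D ∧ ∀ x ∈ D, fuchsianOp p b z x = g x := by
  have : CompleteSpace E := FiniteDimensional.complete ℂ E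
  -- The family of differences indexed by pairs turns the statement on null families into a locally
  -- uniform Cauchy property of `y`.
  have hpair : TendstoLocallyUniformlyOn
      (fun (m : ℕ × ℕ) => fuchsianOp p b fun t => y m.1 t - y m.2 t) 0 (atTop ×ˢ atTop) D := by
    rw [Metric.tendstoLocallyUniformlyOn_iff] at hlim ⊢
    intro ε hε x hx
    obtain ⟨t, ht, h⟩ := hlim (ε / 2) (half_pos hε) x hx
    refine ⟨t ∩ D, inter_mem ht self_mem_nhdsWithin, ?_⟩
    filter_upwards [h.prod_mk h] with m hm z hz
    have hd : ∀ n, DifferentiableAt ℂ (y n) z := fun n =>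
      ((hy n) z hz.2).differentiableAt (hD.mem_nhds hz.2)
    rw [fuchsianOp_sub (hd _) (hd _), Pi.zero_apply, dist_zero_left, ← dist_eq_norm]
    have h1 := hm.1 z hz.1
    have h2 := hm.2 z hz.1
    linarith [dist_triangle_left (fuchsianOp p b (y m.1) z) (fuchsianOp p b (y m.2) z) (g z)]
  have hcau := tendstoLocallyUniformlyOn_zero_of_fuchsianOp hp hinv hD hDc hpD
    (fun m : ℕ × ℕ => (hy m.1).sub (hy m.2)) hpair
  have hcs : ∀ x ∈ D, CauchySeq fun n => y n x := by
    intro x hx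
    have h1 := hcau.tendsto_at hx
    rw [Metric.cauchySeq_iff]
    intro ε hε
    have h2 := (tendsto_zero_iff_norm_tendsto_zero.1 h1).eventually (gt_mem_nhds hε)
    rw [prod_atTop_atTop_eq, eventually_atTop_prod_self'] at h2
    obtain ⟨N, hN⟩ := h2
    exact ⟨N, fun m hm n hn => by rw [dist_eq_norm]; exact hN m hm n hn⟩
  choose! z hz using fun x (hx : x ∈ D) => cauchySeq_tendsto_of_complete (hcs x hx)
  have hyz : TendstoLocallyUniformlyOn y z atTop D := by
    rw [Metric.tendstoLocallyUniformlyOn_iff] at hcau ⊢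
    intro ε hε x hx
    obtain ⟨t, ht, h⟩ := hcau (ε / 2) (half_pos hε) x hx
    refine ⟨t ∩ D, inter_mem ht self_mem_nhdsWithin, ?_⟩
    rw [prod_atTop_atTop_eq, eventually_atTop_prod_self'] at h
    obtain ⟨N, hN⟩ := h
    filter_upwards [eventually_ge_atTop N] with n hn w hw
    have h3 : ∀ m ≥ N, dist (y m w) (y n w) ≤ ε / 2 := by
      intro m hm
      have := hN m hm n hn w hw.1
      simp only [Pi.zero_apply, dist_zero_left, Pi.sub_apply] at this
      rw [dist_eq_norm]
      exact this.le
    have h4 : Tendsto (fun m => dist (y m w) (y n w)) atTop (𝓝 (dist (z w) (y n w))) :=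
      (hz w hw.2).dist tendsto_const_nhds
    have := le_of_tendsto h4 (eventually_atTop.2 ⟨N, h3⟩)
    linarith
  refine ⟨z, hyz.differentiableOn (Eventually.of_forall hy) hD, fun x hx => ?_⟩
  exact tendsto_nhds_unique (tendstoLocallyUniformlyOn_fuchsianOp hD hy hyz hx)
    (hlim.tendsto_at hx)

end FuchsianOperator

/-! ### Vector-valued polynomial functions. -/

section PolynomialFunctions

variable {E : Type*} [NormedAddCommGroup E] [NormedSpace ℂ E]

/-- Vector-valued polynomial functions of degree less than `n`. -/
def polyFun (E : Type*) [NormedAddCommGroup E] [NormedSpace ℂ E] (n : ℕ) :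
    Submodule ℂ (ℂ → E) where
  carrier := {f | ∃ c : ℕ → E, ∀ x, f x = ∑ k ∈ Finset.range n, x ^ k • c k}
  add_mem' := by
    rintro f g ⟨c, hc⟩ ⟨d, hd⟩
    exact ⟨c + d, fun x => by simp [hc, hd, Finset.sum_add_distrib]⟩
  zero_mem' := ⟨0, fun x => by simp⟩
  smul_mem' := by
    rintro a f ⟨c, hc⟩
    exact ⟨a • c, fun x => by simp [hc, Finset.smul_sum, smul_comm a]⟩

theorem polyFun_mono {m n : ℕ} (h : m ≤ n) : polyFun E m ≤ polyFun E n := by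
  rintro f ⟨c, hc⟩
  refine ⟨fun k => if k < m then c k else 0, fun x => ?_⟩
  rw [hc, ← Finset.sum_subset (Finset.range_subset_range.2 h)]
  · exact Finset.sum_congr rfl fun k hk => by simp [Finset.mem_range.1 hk]
  · intro k _ hk
    simp [show ¬ k < m by simpa using hk]

theorem eval_smul_mem_polyFun {n : ℕ} {q : ℂ[X]} (hq : q ∈ Polynomial.degreeLT ℂ n) (v : E) :
    (fun x => q.eval x • v) ∈ polyFun E n := by
  refine ⟨fun k => q.coeff k • v, fun x => ?_⟩
  rcases eq_or_ne q 0 with rfl | hq0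
  · simp
  rw [Polynomial.mem_degreeLT, ← Polynomial.natDegree_lt_iff_degree_lt hq0] at hq
  simp only [Polynomial.eval_eq_sum_range' hq, Finset.sum_smul, smul_smul, mul_comm]

theorem pow_smul_mem_polyFun {k n : ℕ} (h : k < n) (v : E) :
    (fun x : ℂ => x ^ k • v) ∈ polyFun E n := by
  simpa using eval_smul_mem_polyFun (q := X ^ k) (n := n)
    (Polynomial.mem_degreeLT.2 ((degree_X_pow_le k).trans_lt (by exact_mod_cast h))) v

theorem exists_of_mem_polyFun_succ {n : ℕ} {f : ℂ → E} (hf : f ∈ polyFun E (n + 1)) :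
    ∃ (w : E) (f' : ℂ → E), f' ∈ polyFun E n ∧ f = fun x => f' x + x ^ n • w := by
  obtain ⟨c, hc⟩ := hf
  exact ⟨c n, fun x => ∑ k ∈ Finset.range n, x ^ k • c k, ⟨c, fun _ => rfl⟩,
    funext fun x => by rw [hc, Finset.sum_range_succ]⟩

theorem differentiable_of_mem_polyFun {n : ℕ} {f : ℂ → E} (hf : f ∈ polyFun E n) :
    Differentiable ℂ f := by
  obtain ⟨c, hc⟩ := hf
  rw [show f = fun x => ∑ k ∈ Finset.range n, x ^ k • c k from funext hc]
  fun_prop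

/-- Linear functionals reduce this to comparing coefficients of scalar polynomials. -/
theorem eq_zero_of_pow_smul_mem_polyFun {n : ℕ} {w : E}
    (h : (fun x : ℂ => x ^ n • w) ∈ polyFun E n) : w = 0 := by
  obtain ⟨c, hc⟩ := h
  rw [← Module.forall_dual_apply_eq_zero_iff ℂ]
  intro φ
  have h0 : (C (φ w) * X ^ n : ℂ[X]) = ∑ k ∈ Finset.range n, C (φ (c k)) * X ^ k := by
    refine Polynomial.funext fun x => ?_
    have := congrArg φ (hc x)
    simp only [map_smul, map_sum, smul_eq_mul] at this
    simp only [eval_mul, eval_C, eval_pow, eval_X, Polynomial.eval_finsetSum]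
    rw [mul_comm, this]
    exact Finset.sum_congr rfl fun k _ => mul_comm _ _
  have h1 := congrArg (fun q => q.coeff n) h0
  simpa [Polynomial.finsetSum_coeff, Polynomial.coeff_X_pow] using h1

end PolynomialFunctions

/-! ### Division with remainder by the operator on polynomials. -/

section Algebra

variable {ι E : Type*} [Fintype ι] [DecidableEq ι] [NormedAddCommGroup E] [NormedSpace ℂ E]
  {p : ι → ℂ} {b : ι → E →L[ℂ] E}

theorem prod_X_sub_C_sub_X_pow_mem {ι : Type*} (p : ι → ℂ) (s : Finset ι) :
    (∏ i ∈ s, (X - C (p i))) - X ^ s.card ∈ Polynomial.degreeLT ℂ s.card := by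
  rw [Polynomial.mem_degreeLT]
  have hm : (∏ i ∈ s, (X - C (p i))).Monic := Polynomial.monic_prod_X_sub_C p s
  have hd : (∏ i ∈ s, (X - C (p i))).degree = (s.card : WithBot ℕ) := by
    rw [Polynomial.degree_prod]; simp
  refine (Polynomial.degree_sub_lt_left ?_ hm.ne_zero ?_).trans_eq hd
  · rw [hd, degree_X_pow]
  · rw [hm.leadingCoeff, (monic_X_pow _).leadingCoeff]

theorem mul_X_pow_mem_degreeLT {n d : ℕ} {q : ℂ[X]} (hq : q ∈ Polynomial.degreeLT ℂ n) :
    q * X ^ d ∈ Polynomial.degreeLT ℂ (n + d) := by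
  rw [Polynomial.mem_degreeLT] at *
  rw [degree_mul, degree_X_pow, Nat.cast_add]
  exact WithBot.add_lt_add_right (by simp) hq

/-- The leading term of the Fuchsian operator on monomials. -/
theorem fuchsianOp_monomial_sub_mem {m : ℕ} (hm : Fintype.card ι = m + 1) (d : ℕ) (v : E) :
    (fun x => fuchsianOp p b (fun t => t ^ d • v) x -
      x ^ (d + m) • ((d : ℂ) • v + ∑ j, b j v)) ∈ polyFun E (d + m) := by
  -- Each product over `i ≠ j` is monic of degree `m`, so it contributes `b j v` in degree `d + m`;
  -- the full product is monic of degree `m + 1` and, against the derivative, contributes `d v`.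
  have hA : ∀ j, (fun x => (x ^ d * ∏ i ∈ Finset.univ.erase j, (x - p i) - x ^ (d + m)) • b j v) ∈
      polyFun E (d + m) := by
    intro j
    have h1 := prod_X_sub_C_sub_X_pow_mem p (Finset.univ.erase j)
    have hc : (Finset.univ.erase j).card = m := by simp [hm]
    rw [hc] at h1
    have h2 := eval_smul_mem_polyFun (mul_X_pow_mem_degreeLT (d := d) h1) (b j v)
    rw [add_comm m d] at h2
    convert h2 using 3
    simp only [eval_mul, eval_sub, eval_prod, eval_X, eval_C, eval_pow]
    ring
  have hQ : (fun x => ((∏ i, (x - p i)) * (d * x ^ (d - 1)) - d * x ^ (d + m)) • v) ∈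
      polyFun E (d + m) := by
    rcases Nat.eq_zero_or_pos d with rfl | hd
    · simp only [CharP.cast_eq_zero, zero_mul, mul_zero, sub_zero, zero_smul]
      exact (polyFun E (0 + m)).zero_mem
    · obtain ⟨e, rfl⟩ : ∃ e, d = e + 1 := ⟨d - 1, by omega⟩
      have h1 := prod_X_sub_C_sub_X_pow_mem p Finset.univ
      rw [Finset.card_univ, hm] at h1
      have h2 := eval_smul_mem_polyFun (mul_X_pow_mem_degreeLT (d := e) h1) (((e + 1 : ℕ) : ℂ) • v)
      rw [show m + 1 + e = e + 1 + m by ring] at h2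
      convert h2 using 2 with x
      simp only [eval_mul, eval_sub, eval_prod, eval_X, eval_C, eval_pow, smul_smul]
      congr 1
      rw [Nat.add_sub_cancel]
      ring
  have hsum := (polyFun E (d + m)).add_mem hQ
    ((polyFun E (d + m)).sum_mem (t := Finset.univ) fun j _ => hA j)
  convert hsum using 1
  funext x
  have hderiv : deriv (fun t : ℂ => t ^ d • v) x = (d * x ^ (d - 1)) • v := by
    have := ((hasDerivAt_pow d x).smul_const v).deriv
    simpa using this
  simp only [fuchsianOp, hderiv, fuchsianCoeff, Pi.add_apply, Finset.sum_apply, sub_smul,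
    Finset.sum_sub_distrib, smul_add, Finset.smul_sum, map_smul, smul_smul,
    _root_.sum_apply, _root_.smul_apply]
  rw [mul_comm (d : ℂ) (x ^ (d + m))]
  abel

theorem fuchsianOp_mem_polyFun {m : ℕ} (hm : Fintype.card ι = m + 1) {n : ℕ} {y : ℂ → E}
    (hy : y ∈ polyFun E n) : fuchsianOp p b y ∈ polyFun E (n + m) := by
  induction n generalizing y with
  | zero =>
    obtain ⟨c, hc⟩ := hy
    have : y = fun _ => 0 := funext fun x => by simp [hc]
    have : fuchsianOp p b y = 0 := by
      funext x
      simp [this, fuchsianOp]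
    rw [this]
    exact Submodule.zero_mem _
  | succ n ih =>
    obtain ⟨w, y', hy', rfl⟩ := exists_of_mem_polyFun_succ hy
    have h1 := polyFun_mono (show n + m ≤ n + 1 + m by omega) (ih hy')
    have h2 := polyFun_mono (show n + m ≤ n + 1 + m by omega)
      (fuchsianOp_monomial_sub_mem (p := p) (b := b) hm n w)
    have h3 := pow_smul_mem_polyFun (show n + m < n + 1 + m by omega) ((n : ℂ) • w + ∑ j, b j w)
    have h4 := add_mem h1 (add_mem h2 h3)
    convert h4 using 1
    funext x
    rw [fuchsianOp_add (differentiable_of_mem_polyFun hy' x) (by fun_prop)]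
    simp

/-- A top coefficient `w` in degree `n` would give `(n + B_∞) w` in degree `n + m`, outside the
degrees below `m`; injectivity kills it and the degree drops. -/
theorem eq_zero_of_fuchsianOp_mem_polyFun {m : ℕ} (hm : Fintype.card ι = m + 1)
    (hinf : ∀ k : ℕ, Function.Injective fun v : E => (k : ℂ) • v + ∑ j, b j v)
    {n : ℕ} {y : ℂ → E} (hy : y ∈ polyFun E n) (hL : fuchsianOp p b y ∈ polyFun E m) : y = 0 := by
  induction n with
  | zero =>
    obtain ⟨c, hc⟩ := hy
    exact funext fun x => by simp [hc]
  | succ n ih =>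
    obtain ⟨w, y', hy', rfl⟩ := exists_of_mem_polyFun_succ hy
    have h1 := fuchsianOp_mem_polyFun (p := p) (b := b) hm hy'
    have h2 := fuchsianOp_monomial_sub_mem (p := p) (b := b) hm n w
    have h3 := sub_mem (polyFun_mono (show m ≤ n + m by omega) hL) (add_mem h1 h2)
    have hw : (n : ℂ) • w + ∑ j, b j w = 0 := by
      refine eq_zero_of_pow_smul_mem_polyFun (n := n + m) ?_
      convert h3 using 1
      funext x
      simp only [Pi.sub_apply, Pi.add_apply]
      rw [fuchsianOp_add (differentiable_of_mem_polyFun hy' x) (by fun_prop)]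
      abel
    have hw0 : w = 0 := hinf n (by simpa using hw)
    refine ih ?_
    simpa [hw0] using hy'

/-- Division by the Fuchsian operator in the space of polynomials. -/
theorem exists_fuchsianOp_add_eq_of_mem_polyFun {m : ℕ} (hm : Fintype.card ι = m + 1)
    (hinf : ∀ k : ℕ, Function.Surjective fun v : E => (k : ℂ) • v + ∑ j, b j v)
    {n : ℕ} {f : ℂ → E} (hf : f ∈ polyFun E n) :
    ∃ y φ : ℂ → E, Differentiable ℂ y ∧ φ ∈ polyFun E m ∧
      ∀ x, fuchsianOp p b y x + φ x = f x := by
  induction n generalizing f with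
  | zero =>
    refine ⟨fun _ => 0, f, by fun_prop, polyFun_mono (Nat.zero_le m) hf, fun x => ?_⟩
    simp [fuchsianOp]
  | succ n ih =>
    rcases Nat.lt_or_ge n m with h | h
    · refine ⟨fun _ => 0, f, by fun_prop, polyFun_mono h hf, fun x => ?_⟩
      simp [fuchsianOp]
    · obtain ⟨d, rfl⟩ : ∃ d, n = d + m := ⟨n - m, by omega⟩
      obtain ⟨w, f', hf', rfl⟩ := exists_of_mem_polyFun_succ hf
      -- The monomial `x ^ d • v` cancels the top coefficient `w`. Degrees below `m`, treated above,
      -- are left in the remainder.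
      obtain ⟨v, hv⟩ := hinf d w
      simp only at hv
      have h2 := fuchsianOp_monomial_sub_mem (p := p) (b := b) hm d v
      obtain ⟨y, φ, hy, hφ, heq⟩ := ih (sub_mem hf' h2)
      refine ⟨fun x => y x + x ^ d • v, φ, by fun_prop, hφ, fun x => ?_⟩
      have := heq x
      rw [fuchsianOp_add (hy x) (by fun_prop)]
      simp only [Pi.sub_apply, hv] at this
      rw [add_right_comm, this]
      abel_nf

end Algebra

/-! ### Moving finitely many points of a plane domain into a disc. -/

section MovingPoints

/-- A homeomorphism supported in a disc that moves its centre to a prescribed point. -/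
theorem exists_homeomorph_center_to {c y : ℂ} {r : ℝ} (hy : y ∈ ball c r) :
    ∃ h : ℂ ≃ₜ ℂ, h c = y ∧ ∀ x ∉ ball c r, h x = x := by
  have hr : 0 < r := pos_of_mem_ball hy
  -- A tent-shaped perturbation of the identity, with Lipschitz constant `‖y - c‖ / r < 1`, hence a
  -- homeomorphism.
  set f : ℂ → ℂ := fun x => x + (max 0 (1 - ‖x - c‖ / r)) • (y - c) with hf
  have hN : ‖((ContinuousLinearEquiv.refl ℝ ℂ).symm : ℂ →L[ℝ] ℂ)‖₊ = 1 := by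
    rw [← NNReal.coe_inj, coe_nnnorm, NNReal.coe_one]
    exact ContinuousLinearMap.norm_id
  have happ : ApproximatesLinearOn f ((ContinuousLinearEquiv.refl ℝ ℂ : ℂ ≃L[ℝ] ℂ) : ℂ →L[ℝ] ℂ)
      univ (‖y - c‖₊ / r.toNNReal) := by
    intro x _ z _
    have h1 : f x - f z - ((ContinuousLinearEquiv.refl ℝ ℂ : ℂ ≃L[ℝ] ℂ) : ℂ →L[ℝ] ℂ) (x - z)
        = (max 0 (1 - ‖x - c‖ / r) - max 0 (1 - ‖z - c‖ / r)) • (y - c) := by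
      simp only [hf, ContinuousLinearEquiv.coe_coe, ContinuousLinearEquiv.refl_apply, sub_smul]
      abel
    rw [h1, norm_smul, NNReal.coe_div, coe_nnnorm, Real.coe_toNNReal r hr.le, Real.norm_eq_abs]
    have h2 : |max 0 (1 - ‖x - c‖ / r) - max 0 (1 - ‖z - c‖ / r)| ≤ ‖x - z‖ / r := by
      have h3 := abs_max_sub_max_le_max 0 (1 - ‖x - c‖ / r) 0 (1 - ‖z - c‖ / r)
      have h4 : |(1 - ‖x - c‖ / r) - (1 - ‖z - c‖ / r)| ≤ ‖x - z‖ / r := by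
        rw [show (1 - ‖x - c‖ / r) - (1 - ‖z - c‖ / r) = (‖z - c‖ - ‖x - c‖) / r by ring,
          abs_div, abs_of_pos hr]
        gcongr
        have := abs_norm_sub_norm_le (z - c) (x - c)
        rwa [sub_sub_sub_cancel_right, norm_sub_rev z x] at this
      rw [sub_self, abs_zero] at h3
      exact h3.trans (max_le (by positivity) h4)
    calc _ ≤ ‖x - z‖ / r * ‖y - c‖ := by gcongr
      _ = _ := by ring
  have hlt : ‖y - c‖₊ / r.toNNReal < ‖((ContinuousLinearEquiv.refl ℝ ℂ).symm : ℂ →L[ℝ] ℂ)‖₊⁻¹ := by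
    rw [hN, inv_one, div_lt_one (by simpa using hr), ← NNReal.coe_lt_coe, coe_nnnorm,
      Real.coe_toNNReal r hr.le]
    simpa [dist_eq_norm] using hy
  refine ⟨happ.toHomeomorph f (Or.inr hlt), ?_, fun x hx => ?_⟩
  · change f c = y
    simp [hf]
  · change f x = x
    have : 1 ≤ ‖x - c‖ / r := by
      rw [one_le_div hr]
      simpa [dist_eq_norm] using hx
    rw [hf]
    simp only
    rw [max_eq_left (by linarith), zero_smul, add_zero]

/-- The homeomorphisms supported in a connected open set act transitively on it. -/
theorem exists_homeomorph_move {U : Set ℂ} (hU : IsOpen U) (hUc : IsPreconnected U) {x y : ℂ}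
    (hx : x ∈ U) (hy : y ∈ U) : ∃ h : ℂ ≃ₜ ℂ, h x = y ∧ ∀ z ∉ U, h z = z := by
  refine hUc.induction₂ (fun x y => ∃ h : ℂ ≃ₜ ℂ, h x = y ∧ ∀ z ∉ U, h z = z) ?_ ?_ ?_ hx hy
  · intro a ha
    obtain ⟨r, hr, hrU⟩ := Metric.isOpen_iff.1 hU a ha
    filter_upwards [mem_nhdsWithin_of_mem_nhds (ball_mem_nhds a hr)] with z hz
    obtain ⟨h, h1, h2⟩ := exists_homeomorph_center_to hz
    exact ⟨h, h1, fun w hw => h2 w fun hwb => hw (hrU hwb)⟩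
  · rintro a b c - - - ⟨h, h1, h2⟩ ⟨k, k1, k2⟩
    exact ⟨h.trans k, by simp [h1, k1], fun z hz => by simp [h2 z hz, k2 z hz]⟩
  · rintro a b - - ⟨h, h1, h2⟩
    exact ⟨h.symm, by simp [← h1], fun z hz => by
      rw [Homeomorph.symm_apply_eq, h2 z hz]⟩

/-- The disc is homeomorphic to the plane, where complements of countable sets are connected. -/
theorem isPreconnected_ball_diff_countable {c : ℂ} {r : ℝ} (hr : 0 < r) {F : Set ℂ}
    (hF : F.Countable) : IsPreconnected (ball c r \ F) := by
  have hinj : Function.Injective (OpenPartialHomeomorph.univBall c r : ℂ → ℂ) := by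
    have := (OpenPartialHomeomorph.univBall c r).injOn
    rwa [OpenPartialHomeomorph.univBall_source, injOn_univ] at this
  have himage : (OpenPartialHomeomorph.univBall c r : ℂ → ℂ) '' univ = ball c r := by
    have := (OpenPartialHomeomorph.univBall c r).image_source_eq_target
    rwa [OpenPartialHomeomorph.univBall_source, OpenPartialHomeomorph.univBall_target c hr] at this
  have h1 : ball c r \ F = (OpenPartialHomeomorph.univBall c r : ℂ → ℂ) ''
      ((OpenPartialHomeomorph.univBall c r : ℂ → ℂ) ⁻¹' F)ᶜ := by
    rw [← himage, ← preimage_compl, image_preimage_eq_inter_range, image_univ, sdiff_eq, inter_comm]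
  rw [h1]
  exact ((hF.preimage hinj).isConnected_compl_of_one_lt_rank
    (by simp)).isPreconnected.image _
    (OpenPartialHomeomorph.continuous_univBall c r).continuousOn

/-- Removing a finite set does not disconnect a plane domain. -/
theorem isPreconnected_diff_finite {U F : Set ℂ} (hU : IsOpen U) (hUc : IsPreconnected U)
    (hF : F.Finite) : IsPreconnected (U \ F) := by
  -- With punctured neighbourhoods the relation makes sense for points of `F` too, so it can be
  -- chained through all of `U`; two punctured neighbourhoods of the middle point always meet.
  have key : ∀ x ∈ U, ∀ y ∈ U, ∃ C, IsPreconnected C ∧ C ⊆ U \ F ∧ C ∈ 𝓝[≠] x ∧ C ∈ 𝓝[≠] y := by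
    intro x hx y hy
    refine hUc.induction₂
      (fun x y => ∃ C, IsPreconnected C ∧ C ⊆ U \ F ∧ C ∈ 𝓝[≠] x ∧ C ∈ 𝓝[≠] y) ?_ ?_ ?_ hx hy
    · intro a ha
      obtain ⟨r, hr, hrU⟩ := Metric.isOpen_iff.1 hU a ha
      have hmem : ∀ z ∈ ball a r, ball a r \ F ∈ 𝓝[≠] z := by
        intro z hz
        have h1 : (F \ {z})ᶜ ∈ 𝓝 z := (hF.subset sdiff_subset).isClosed.isOpen_compl.mem_nhds
          (by simp)
        filter_upwards [mem_nhdsWithin_of_mem_nhds (isOpen_ball.mem_nhds hz),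
          mem_nhdsWithin_of_mem_nhds h1, self_mem_nhdsWithin] with w h2 h3 h4
        exact ⟨h2, fun hw => h3 ⟨hw, h4⟩⟩
      filter_upwards [mem_nhdsWithin_of_mem_nhds (ball_mem_nhds a hr)] with z hz
      exact ⟨ball a r \ F, isPreconnected_ball_diff_countable hr hF.countable,
        sdiff_subset_sdiff_left hrU, hmem a (mem_ball_self hr), hmem z hz⟩
    · rintro a b c - - - ⟨C, hC, hCU, hCa, hCb⟩ ⟨C', hC', hCU', hCb', hCc'⟩
      obtain ⟨z, hz, hz'⟩ := (NeBot.nonempty_of_mem inferInstance (inter_mem hCb hCb'))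
      exact ⟨C ∪ C', hC.union z hz hz' hC', union_subset hCU hCU',
        mem_of_superset hCa subset_union_left, mem_of_superset hCc' subset_union_right⟩
    · rintro a b - - ⟨C, hC, hCU, hCa, hCb⟩
      exact ⟨C, hC, hCU, hCb, hCa⟩
  refine isPreconnected_of_forall_pair fun x hx y hy => ?_
  obtain ⟨C, hC, hCU, hCx, hCy⟩ := key x hx.1 y hy.1
  have hcl : ∀ z, C ∈ 𝓝[≠] z → z ∈ closure C := fun z hz =>
    mem_closure_iff_nhdsWithin_neBot.2 (NeBot.mono (f := 𝓝[≠] z) inferInstance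
      (le_inf nhdsWithin_le_nhds (le_principal_iff.2 hz)))
  refine ⟨insert x (insert y C), ?_, by simp, by simp, hC.subset_closure
    ((subset_insert _ _).trans (subset_insert _ _)) ?_⟩
  · exact insert_subset hx (insert_subset hy hCU)
  · exact insert_subset (hcl x hCx) (insert_subset (hcl y hCy) subset_closure)

/-- A finite subset of a plane domain can be moved into a given disc by a homeomorphism supported
in the domain. -/
theorem exists_homeomorph_finset_to_ball {D : Set ℂ} (hD : IsOpen D) (hDc : IsPreconnected D)
    {c : ℂ} {r : ℝ} (hr : 0 < r) (hball : ball c r ⊆ D) (F : Finset ℂ) (hF : ∀ x ∈ F, x ∈ D) :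
    ∃ h : ℂ ≃ₜ ℂ, (∀ x ∉ D, h x = x) ∧ ∀ x ∈ F, h x ∈ ball c r := by
  classical
  induction F using Finset.induction_on with
  | empty => exact ⟨Homeomorph.refl ℂ, by simp⟩
  | insert a F ha ih =>
    obtain ⟨h, h1, h2⟩ := ih fun x hx => hF x (Finset.mem_insert_of_mem hx)
    have hfin : (h '' (F : Set ℂ)).Finite := F.finite_toSet.image h
    have haD : h a ∈ D := by
      by_contra hc
      have := h.injective (h1 _ hc)
      rw [this] at hc
      exact hc (hF a (Finset.mem_insert_self a F))
    have haU : h a ∈ D \ h '' (F : Set ℂ) := ⟨haD, fun ⟨z, hz, hza⟩ => by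
      rw [h.injective hza] at hz
      exact ha hz⟩
    obtain ⟨w, hw, hwF⟩ : ∃ w ∈ ball c r, w ∉ h '' (F : Set ℂ) := by
      have hinf : (ball c r).Infinite := infinite_of_mem_nhds c (ball_mem_nhds c hr)
      exact (hinf.sdiff hfin).nonempty
    -- The next motion is supported off the points already placed, so these stay where they are.
    obtain ⟨k, k1, k2⟩ := exists_homeomorph_move (hD.sdiff hfin.isClosed)
      (isPreconnected_diff_finite hD hDc hfin) haU ⟨hball hw, hwF⟩
    refine ⟨h.trans k, fun x hx => ?_, fun x hx => ?_⟩
    · rw [Homeomorph.trans_apply, h1 x hx]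
      exact k2 x fun hx' => hx hx'.1
    · rw [Homeomorph.trans_apply]
      rcases Finset.mem_insert.1 hx with rfl | hx
      · rw [k1]; exact hw
      · rw [k2 _ fun hx' => hx'.2 ⟨x, hx, rfl⟩]
        exact h2 x hx

end MovingPoints

/-! ### Local solutions of linear differential equations. -/

section LinearODE

variable {E : Type*} [NormedAddCommGroup E] [NormedSpace ℂ E] [CompleteSpace E]

theorem exists_primitive_norm_le {c : ℂ} {r : ℝ} {f : ℂ → E} (hf : DifferentiableOn ℂ f (ball c r))
    {M : ℝ} (hM : ∀ x ∈ ball c r, ‖f x‖ ≤ M) {x₀ : ℂ} (hx₀ : x₀ ∈ ball c r) :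
    ∃ F : ℂ → E, F x₀ = 0 ∧ (∀ x ∈ ball c r, HasDerivAt F (f x) x) ∧
      ∀ x ∈ ball c r, ‖F x‖ ≤ M * (2 * r) := by
  obtain ⟨F, hF0, hF⟩ := hf.isExactOn_ball.with_val_at x₀ 0
  refine ⟨F, hF0, hF, fun x hx => ?_⟩
  have h1 := (convex_ball c r).norm_image_sub_le_of_norm_hasDerivWithin_le (C := M)
    (fun x hx => (hF x hx).hasDerivWithinAt) hM hx₀ hx
  rw [hF0, sub_zero] at h1
  have hM0 : 0 ≤ M := (norm_nonneg _).trans (hM x hx)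
  refine h1.trans (mul_le_mul_of_nonneg_left ?_ hM0)
  rw [← dist_eq_norm]
  rw [mem_ball] at hx hx₀
  linarith [dist_triangle_right x x₀ c]

/-- Linear differential equations have analytic solutions on small discs. -/
theorem exists_hasDerivAt_linear {c : ℂ} {r a M : ℝ} {A : ℂ → E →L[ℂ] E} {G : ℂ → E}
    (hA : DifferentiableOn ℂ A (ball c r)) (hAa : ∀ x ∈ ball c r, ‖A x‖ ≤ a) (har : 4 * (a * r) ≤ 1)
    (hG : DifferentiableOn ℂ G (ball c r)) (hGM : ∀ x ∈ ball c r, ‖G x‖ ≤ M)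
    {x₀ : ℂ} (hx₀ : x₀ ∈ ball c r) (v : E) :
    ∃ y : ℂ → E, y x₀ = v ∧ ∀ x ∈ ball c r, HasDerivAt y (G x - A x (y x)) x := by
  have ha0 : 0 ≤ a := (norm_nonneg _).trans (hAa x₀ hx₀)
  have hr : 0 < r := pos_of_mem_ball hx₀
  obtain ⟨F₀, hF₀0, hF₀, hF₀b⟩ := exists_primitive_norm_le hG hGM hx₀
  set K := ‖v‖ + M * (2 * r) with hK
  -- Picard iteration as a series: the first term is `v` plus a primitive of `G`, each later one a
  -- primitive of `-A` applied to its predecessor. A step costs at most `a * (2 * r) ≤ 1 / 2`,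
  -- whence the geometric bound.
  let P : ℕ → (ℂ → E) → Prop := fun n f =>
    DifferentiableOn ℂ f (ball c r) ∧ ∀ x ∈ ball c r, ‖f x‖ ≤ K * (1 / 2) ^ n
  have hstep : ∀ n f, P n f → ∃ F : ℂ → E, P (n + 1) F ∧ F x₀ = 0 ∧
      ∀ x ∈ ball c r, HasDerivAt F (-(A x (f x))) x := by
    rintro n f ⟨hf, hfb⟩
    obtain ⟨F, h0, h1, h2⟩ := exists_primitive_norm_le (f := fun x => -(A x (f x)))
      (M := a * (K * (1 / 2) ^ n)) (hA.clm_apply hf).neg (fun x hx => by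
        rw [norm_neg]
        exact ((A x).le_of_opNorm_le (hAa x hx) _).trans
          (mul_le_mul_of_nonneg_left (hfb x hx) ha0)) hx₀
    refine ⟨F, ⟨fun x hx => (h1 x hx).differentiableAt.differentiableWithinAt, fun x hx => ?_⟩,
      h0, h1⟩
    refine (h2 x hx).trans ?_
    have : 0 ≤ K * (1 / 2) ^ n := (norm_nonneg _).trans (hfb x hx)
    rw [pow_succ]
    nlinarith
  have h0P : P 0 (fun x => v + F₀ x) := by
    refine ⟨fun x hx => ((hF₀ x hx).const_add v).differentiableAt.differentiableWithinAt,
      fun x hx => ?_⟩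
    rw [pow_zero, mul_one]
    exact (norm_add_le _ _).trans (add_le_add le_rfl (hF₀b x hx))
  choose! next hnext using hstep
  let u : ℕ → ℂ → E := fun n => Nat.rec (fun x => v + F₀ x) (fun n f => next n f) n
  have hu : ∀ n, P n (u n) := by
    intro n
    induction n with
    | zero => exact h0P
    | succ n ih => exact (hnext n (u n) ih).1
  have husucc : ∀ n, u (n + 1) x₀ = 0 ∧ ∀ x ∈ ball c r,
      HasDerivAt (u (n + 1)) (-(A x (u n x))) x := fun n => (hnext n (u n) (hu n)).2
  have hsum : Summable fun n : ℕ => K * (1 / 2 : ℝ) ^ n := summable_geometric_two.mul_left K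
  have hsumx : ∀ x ∈ ball c r, Summable fun n => u n x := fun x hx =>
    Summable.of_norm_bounded hsum fun n => (hu n).2 x hx
  refine ⟨fun x => ∑' n, u n x, ?_, fun x hx => ?_⟩
  · change ∑' n, u n x₀ = v
    rw [(hsumx x₀ hx₀).tsum_eq_zero_add]
    simp only [(husucc _).1, tsum_zero, add_zero]
    change v + F₀ x₀ = v
    rw [hF₀0, add_zero]
  · have hd := Complex.differentiableOn_tsum_of_summable_norm hsum (fun n => (hu n).1) isOpen_ball
      fun n x hx => (hu n).2 x hx
    have hdx := ((hd x hx).differentiableAt (isOpen_ball.mem_nhds hx)).hasDerivAt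
    have hs := Complex.hasSum_deriv_of_summable_norm hsum (fun n => (hu n).1) isOpen_ball
      (fun n x hx => (hu n).2 x hx) hx
    have hs0 : deriv (u 0) x = G x := ((hF₀ x hx).const_add v).deriv
    have hs1 : ∀ n, deriv (u (n + 1)) x = -(A x (u n x)) := fun n => ((husucc n).2 x hx).deriv
    have h2 : HasSum (fun n => deriv (u (n + 1)) x) (-(A x (∑' n, u n x))) := by
      simp only [hs1]
      exact ((A x).hasSum (hsumx x hx).hasSum).neg
    have h3 := (hasSum_nat_add_iff' 1).2 hs
    simp only [Finset.range_one, Finset.sum_singleton, hs0] at h3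
    have h4 := h3.unique h2
    refine hdx.congr_deriv ?_
    rw [sub_eq_add_neg, ← h4]
    abel

end LinearODE

/-! ### Continuation of solutions to the whole plane. -/

section Continuation

variable {ι E : Type*} [Fintype ι] [DecidableEq ι] [NormedAddCommGroup E] [NormedSpace ℂ E]
  {p : ι → ℂ} {b : ι → E →L[ℂ] E} {g : ℂ → E}

/-- `y` is an analytic solution on `U` of the equation `Q y' + Q B y = g`. -/
def IsSolOn (p : ι → ℂ) (b : ι → E →L[ℂ] E) (g : ℂ → E) (U : Set ℂ) (y : ℂ → E) : Prop :=
  DifferentiableOn ℂ y U ∧ ∀ x ∈ U, fuchsianOp p b y x = g x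

theorem IsSolOn.mono {U V : Set ℂ} {y : ℂ → E} (h : IsSolOn p b g V y) (hUV : U ⊆ V) :
    IsSolOn p b g U y :=
  ⟨h.1.mono hUV, fun x hx => h.2 x (hUV hx)⟩

theorem exists_isSolOn_iUnion {κ : Type*} {W : κ → Set ℂ} (hW : ∀ i, IsOpen (W i))
    {y : κ → ℂ → E} (hy : ∀ i, IsSolOn p b g (W i) (y i))
    (hagree : ∀ i j, EqOn (y i) (y j) (W i ∩ W j)) :
    ∃ z, IsSolOn p b g (⋃ i, W i) z := by
  classical
  let z : ℂ → E := fun x => if h : ∃ i, x ∈ W i then y h.choose x else 0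
  have hz : ∀ i, EqOn z (y i) (W i) := by
    intro i x hx
    have h : ∃ i, x ∈ W i := ⟨i, hx⟩
    simp only [z, dif_pos h]
    exact hagree _ _ ⟨h.choose_spec, hx⟩
  have hloc : ∀ i, ∀ x ∈ W i, z =ᶠ[𝓝 x] y i := fun i x hx =>
    (hz i).eventuallyEq_of_mem ((hW i).mem_nhds hx)
  refine ⟨z, fun x hx => ?_, fun x hx => ?_⟩
  · obtain ⟨i, hi⟩ := mem_iUnion.1 hx
    have := ((hy i).1 x hi).differentiableAt ((hW i).mem_nhds hi)
    exact ((hloc i x hi).differentiableAt_iff.2 this).differentiableWithinAt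
  · obtain ⟨i, hi⟩ := mem_iUnion.1 hx
    rw [fuchsianOp_congr (hloc i x hi), (hy i).2 x hi]

theorem IsSolOn.sub_fuchsianOp {U : Set ℂ} (hU : IsOpen U) {y z : ℂ → E}
    (hy : IsSolOn p b g U y) (hz : IsSolOn p b g U z) {x : ℂ} (hx : x ∈ U) :
    fuchsianOp p b (fun t => y t - z t) x = 0 := by
  rw [fuchsianOp_sub ((hy.1 x hx).differentiableAt (hU.mem_nhds hx))
    ((hz.1 x hx).differentiableAt (hU.mem_nhds hx)), hy.2 x hx, hz.2 x hx, sub_self]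

/-- No initial value is needed: the singular points determine the solution. This is continuous
dependence for a one-member family along `pure ()`, where tending to zero means being zero. -/
theorem IsSolOn.eqOn_of_singular [FiniteDimensional ℂ E] [Nonempty ι] (hp : Function.Injective p)
    (hinv : ∀ (k : ℕ) (j : ι), Function.Injective fun v : E => (k : ℂ) • v + b j v)
    {U : Set ℂ} (hU : IsOpen U) (hUc : IsPreconnected U) (hpU : ∀ j, p j ∈ U) {y z : ℂ → E}
    (hy : IsSolOn p b g U y) (hz : IsSolOn p b g U z) : EqOn y z U := by
  have h := tendstoLocallyUniformlyOn_zero_of_fuchsianOp (p := p) (b := b) (κ := Unit)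
    (l := pure ()) hp hinv hU hUc hpU (y := fun _ t => y t - z t) (fun _ => hy.1.sub hz.1) (by
      rw [Metric.tendstoLocallyUniformlyOn_iff]
      refine fun ε hε x hx => ⟨U, self_mem_nhdsWithin, Eventually.of_forall fun _ w hw => ?_⟩
      rw [hy.sub_fuchsianOp hU hz hw]
      simpa using hε)
  intro x hx
  have h1 := h.tendsto_at hx
  have h2 := tendsto_nhds_unique h1 (tendsto_pure_nhds (fun _ : Unit => y x - z x) ())
  exact sub_eq_zero.1 h2.symm

theorem IsSolOn.eqOn_of_regular [CompleteSpace E] {U : Set ℂ} (hU : IsOpen U)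
    (hUc : IsPreconnected U)
    (hpU : ∀ j, p j ∉ U) {y z : ℂ → E} (hy : IsSolOn p b g U y) (hz : IsSolOn p b g U z)
    {x₀ : ℂ} (hx₀ : x₀ ∈ U) (h0 : y x₀ = z x₀) : EqOn y z U := by
  obtain ⟨r, hr, hball⟩ := exists_ball_avoiding (p := p) hU hx₀ fun j h => hpU j (h ▸ hx₀)
  have h := tendstoUniformlyOn_zero_of_regular (p := p) (b := b) (κ := Unit) (l := pure ())
    hU hr hball (y := fun _ t => y t - z t) (fun _ => hy.1.sub hz.1) (by
      rw [Metric.tendstoLocallyUniformlyOn_iff]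
      refine fun ε hε x hx => ⟨U, self_mem_nhdsWithin, Eventually.of_forall fun _ w hw => ?_⟩
      rw [hy.sub_fuchsianOp hU hz hw]
      simpa using hε) (mem_ball_self hr) (by simp [h0])
  have hzero : (fun t => y t - z t) =ᶠ[𝓝 x₀] 0 := by
    filter_upwards [ball_mem_nhds x₀ hr] with x hx
    exact (tendsto_nhds_unique (h.tendsto_at hx)
      (tendsto_pure_nhds (fun _ : Unit => y x - z x) ())).symm
  have := (((hy.1.sub hz.1).analyticOnNhd hU).eqOn_zero_of_preconnected_of_eventuallyEq_zero
    hUc hx₀ hzero)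
  exact fun x hx => sub_eq_zero.1 (this hx)

theorem exists_ball_isSolOn [CompleteSpace E] (hg : Differentiable ℂ g) {c : ℂ}
    (hc : ∀ j, c ≠ p j) :
    ∃ r > 0, (∀ j, p j ∉ ball c r) ∧
      ∀ x₀ ∈ ball c r, ∀ v : E, ∃ y, y x₀ = v ∧ IsSolOn p b g (ball c r) y := by
  obtain ⟨R, hR, hball⟩ := exists_ball_avoiding isOpen_univ (mem_univ c) hc
  set Q : ℂ → ℂ := fun x => ∏ j, (x - p j) with hQ
  have hQd : Differentiable ℂ Q := by rw [hQ]; fun_prop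
  have hQ0 : ∀ x ∈ closedBall c R, Q x ≠ 0 := fun x hx =>
    Finset.prod_ne_zero_iff.2 fun j _ => sub_ne_zero.2 ((hball x hx).2 j)
  have hQi : DifferentiableOn ℂ (fun x => (Q x)⁻¹) (closedBall c R) :=
    hQd.differentiableOn.inv hQ0
  have hA : DifferentiableOn ℂ (fun x => (Q x)⁻¹ • fuchsianCoeff p b x) (closedBall c R) :=
    hQi.smul differentiable_fuchsianCoeff.differentiableOn
  have hG : DifferentiableOn ℂ (fun x => (Q x)⁻¹ • g x) (closedBall c R) :=
    hQi.smul hg.differentiableOn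
  obtain ⟨a, ha⟩ := (isCompact_closedBall c R).exists_bound_of_continuousOn hA.continuousOn
  obtain ⟨M, hM⟩ := (isCompact_closedBall c R).exists_bound_of_continuousOn hG.continuousOn
  have ha0 : 0 ≤ a := (norm_nonneg _).trans (ha c (mem_closedBall_self hR.le))
  set r := min R (1 / (4 * (a + 1))) with hr
  have hr0 : 0 < r := lt_min hR (by positivity)
  have hsub : ball c r ⊆ closedBall c R := ball_subset_closedBall.trans
    (closedBall_subset_closedBall (min_le_left _ _))
  have har : 4 * (a * r) ≤ 1 := by
    have h1 : r ≤ 1 / (4 * (a + 1)) := min_le_right _ _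
    rw [le_div_iff₀ (by positivity)] at h1
    nlinarith
  refine ⟨r, hr0, fun j hj => (hball _ (hsub hj)).2 j rfl, fun x₀ hx₀ v => ?_⟩
  obtain ⟨y, hy0, hy⟩ := exists_hasDerivAt_linear (hA.mono hsub) (fun x hx => ha x (hsub hx)) har
    (hG.mono hsub) (fun x hx => hM x (hsub hx)) hx₀ v
  refine ⟨y, hy0, fun x hx => (hy x hx).differentiableAt.differentiableWithinAt, fun x hx => ?_⟩
  rw [fuchsianOp, (hy x hx).deriv, smul_sub, _root_.smul_apply,
    smul_inv_smul₀ (hQ0 x (hsub hx)), smul_inv_smul₀ (hQ0 x (hsub hx)), sub_add_cancel]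

/-- One step of the continuation: a solution on the preimage of a disc under a homeomorphism of
the plane extends to the preimage of a larger concentric disc. -/
theorem exists_isSolOn_preimage_ball_add [CompleteSpace E] (hg : Differentiable ℂ g)
    (h : ℂ ≃ₜ ℂ) {c : ℂ} {s : ℝ} (hs : 0 < s) (hps : ∀ j, h (p j) ∈ ball c s) {y : ℂ → E}
    (hy : IsSolOn p b g (h ⁻¹' ball c s) y) :
    ∃ δ > 0, ∃ z, IsSolOn p b g (h ⁻¹' ball c (s + δ)) z := by
  have hreg : ∀ x : {x // h x ∈ sphere c s}, ∀ j, (x : ℂ) ≠ p j := by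
    rintro ⟨x, hx⟩ j rfl
    exact (mem_ball.1 (hps j)).ne (mem_sphere.1 hx)
  choose ρ hρ hρp hρsol using fun x : {x // h x ∈ sphere c s} =>
    exists_ball_isSolOn (b := b) hg (hreg x)
  -- A Lebesgue number gives one `δ` for the whole circle: the preimage of each `δ`-disc centred on
  -- it lies in a disc on which every initial value problem is solvable.
  obtain ⟨δ, hδ, hleb⟩ := lebesgue_number_lemma_of_metric (isCompact_sphere c s)
    (c := fun x : {x // h x ∈ sphere c s} => h.symm ⁻¹' ball (x : ℂ) (ρ x))
    (fun x => isOpen_ball.preimage h.symm.continuous)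
    (fun w hw => mem_iUnion.2 ⟨⟨h.symm w, by simpa using hw⟩, by
      simp only [mem_preimage]; exact mem_ball_self (hρ _)⟩)
  have hpre : ∀ S : Set ℂ, IsPreconnected S → IsPreconnected (h ⁻¹' S) := fun S hS => by
    rw [← h.image_symm]
    exact hS.image _ h.symm.continuous.continuousOn
  have hmid : ∀ w ∈ sphere c s, ∃ m ∈ ball c s, m ∈ ball w δ := by
    intro w hw
    have h1 : w ∈ closure (ball c s) := by
      rw [closure_ball c hs.ne']; exact sphere_subset_closedBall hw
    obtain ⟨m, hm, hmw⟩ := Metric.mem_closure_iff.1 h1 δ hδ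
    exact ⟨m, hm, by rwa [mem_ball, dist_comm]⟩
  have hlocal : ∀ w : sphere c s, (∀ j, p j ∉ h ⁻¹' ball (w : ℂ) δ) ∧
      ∃ z, IsSolOn p b g (h ⁻¹' ball (w : ℂ) δ) z ∧
        EqOn z y (h ⁻¹' ball (w : ℂ) δ ∩ h ⁻¹' ball c s) := by
    rintro ⟨w, hw⟩
    obtain ⟨x, hx⟩ := hleb w hw
    have hsub : h ⁻¹' ball w δ ⊆ ball (x : ℂ) (ρ x) := by
      intro t ht
      simpa using hx ht
    have hnp : ∀ j, p j ∉ h ⁻¹' ball w δ := fun j hj => hρp x j (hsub hj)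
    refine ⟨hnp, ?_⟩
    obtain ⟨m, hm, hmw⟩ := hmid w hw
    have hmem : h.symm m ∈ h ⁻¹' ball w δ ∩ h ⁻¹' ball c s := by simp [hm, hmw, -mem_ball]
    obtain ⟨z, hz0, hz⟩ := hρsol x (h.symm m) (hsub hmem.1) (y (h.symm m))
    refine ⟨z, hz.mono hsub, ?_⟩
    refine IsSolOn.eqOn_of_regular ((isOpen_ball.preimage h.continuous).inter
      (isOpen_ball.preimage h.continuous)) ?_ (fun j hj => hnp j hj.1)
      (hz.mono (inter_subset_left.trans hsub)) (hy.mono inter_subset_right) hmem hz0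
    rw [← preimage_inter]
    exact hpre _ ((convex_ball w δ).inter (convex_ball c s)).isPreconnected
  choose hnp zz hzz hzy using hlocal
  let W : Option (sphere c s) → Set ℂ := fun o => o.elim (h ⁻¹' ball c s) fun w => h ⁻¹' ball w δ
  let Z : Option (sphere c s) → ℂ → E := fun o => o.elim y zz
  have hglue := exists_isSolOn_iUnion (p := p) (b := b) (g := g) (W := W) (y := Z)
    (by
      rintro (_ | w)
      · exact isOpen_ball.preimage h.continuous
      · exact isOpen_ball.preimage h.continuous)
    (by
      rintro (_ | w)
      · exact hy
      · exact hzz w)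
    (by
      rintro (_ | w) (_ | w')
      · exact fun _ _ => rfl
      · exact fun x hx => (hzy w' ⟨hx.2, hx.1⟩).symm
      · exact hzy w
      · change EqOn (zz w) (zz w') (h ⁻¹' ball (w : ℂ) δ ∩ h ⁻¹' ball (w' : ℂ) δ)
        by_cases hww : w = w'
        · subst hww
          exact fun _ _ => rfl
        rintro x ⟨hx, hx'⟩
        have hd : dist (w : ℂ) w' < 2 * δ := by
          have h1 : dist (h x) w < δ := hx
          have h2 : dist (h x) w' < δ := hx'
          linarith [dist_triangle_left (w : ℂ) w' (h x)]
        -- By strict convexity the midpoint of two distinct points of the circle is inside it, and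
        -- it lies in both `δ`-discs when these meet. Both local solutions equal `y` there, hence
        -- each other on the connected overlap.
        have hmc : midpoint ℝ (w : ℂ) w' ∈ ball c s := by
          have hw1 := w.2
          have hw2 := w'.2
          rw [mem_sphere_iff_norm] at hw1 hw2
          have := (norm_midpoint_lt_iff (x := (w : ℂ) - c) (y := (w' : ℂ) - c)
            (by rw [hw1, hw2])).2 fun he => hww (Subtype.ext (sub_left_injective he))
          rw [hw1] at this
          rw [mem_ball_iff_norm]
          have he : midpoint ℝ (w : ℂ) w' - c = (1 / 2 : ℝ) • ((w : ℂ) - c + ((w' : ℂ) - c)) := by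
            rw [midpoint_eq_smul_add, invOf_eq_inv]
            simp only [Complex.real_smul]
            push_cast
            ring
          rwa [he]
        have hm1 : midpoint ℝ (w : ℂ) w' ∈ ball (w : ℂ) δ := by
          rw [mem_ball, dist_midpoint_left]
          norm_num
          linarith
        have hm2 : midpoint ℝ (w : ℂ) w' ∈ ball (w' : ℂ) δ := by
          rw [mem_ball, dist_midpoint_right]
          norm_num
          linarith
        have hmem : h.symm (midpoint ℝ (w : ℂ) w') ∈
            h ⁻¹' ball (w : ℂ) δ ∩ h ⁻¹' ball (w' : ℂ) δ := by simp [hm1, hm2, -mem_ball]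
        have hmem' : h.symm (midpoint ℝ (w : ℂ) w') ∈ h ⁻¹' ball c s := by simp [hmc, -mem_ball]
        refine IsSolOn.eqOn_of_regular ((isOpen_ball.preimage h.continuous).inter
          (isOpen_ball.preimage h.continuous)) ?_ (fun j hj => hnp w j hj.1)
          ((hzz w).mono inter_subset_left) ((hzz w').mono inter_subset_right) hmem ?_ ⟨hx, hx'⟩
        · rw [← preimage_inter]
          exact hpre _ ((convex_ball _ δ).inter (convex_ball _ δ)).isPreconnected
        · rw [hzy w ⟨hmem.1, hmem'⟩, hzy w' ⟨hmem.2, hmem'⟩])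
  obtain ⟨z, hz⟩ := hglue
  refine ⟨δ, hδ, z, hz.mono fun x hx => ?_⟩
  by_cases hxs : h x ∈ ball c s
  · exact mem_iUnion.2 ⟨none, hxs⟩
  · have hd : s ≤ ‖h x - c‖ := by simpa [dist_eq_norm] using hxs
    have hd0 : 0 < ‖h x - c‖ := hs.trans_le hd
    have hx' : ‖h x - c‖ < s + δ := by simpa [dist_eq_norm] using hx
    -- The radial projection to the circle, at distance `‖h x - c‖ - s < δ`.
    set w : ℂ := c + (s / ‖h x - c‖) • (h x - c) with hw
    have hws : w ∈ sphere c s := by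
      rw [mem_sphere_iff_norm, hw, add_sub_cancel_left, norm_smul, Real.norm_of_nonneg
        (by positivity), div_mul_cancel₀ _ hd0.ne']
    refine mem_iUnion.2 ⟨some ⟨w, hws⟩, ?_⟩
    change dist (h x) w < δ
    have : h x - w = (1 - s / ‖h x - c‖) • (h x - c) := by
      rw [hw, sub_smul, one_smul]; abel
    rw [dist_eq_norm, this, norm_smul, Real.norm_of_nonneg
      (sub_nonneg.2 ((div_le_one hd0).2 hd)), sub_mul, one_mul, div_mul_cancel₀ _ hd0.ne']
    linarith

/-- A solution on the preimage of a disc containing all singular points under a homeomorphism of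
the plane extends to an entire solution. -/
theorem exists_isSolOn_univ [FiniteDimensional ℂ E] [Nonempty ι] (hp : Function.Injective p)
    (hinv : ∀ (k : ℕ) (j : ι), Function.Injective fun v : E => (k : ℂ) • v + b j v)
    (hg : Differentiable ℂ g) (h : ℂ ≃ₜ ℂ) {c : ℂ} {r : ℝ} (hr : 0 < r)
    (hpr : ∀ j, h (p j) ∈ ball c r) {y : ℂ → E} (hy : IsSolOn p b g (h ⁻¹' ball c r) y) :
    ∃ z, IsSolOn p b g univ z := by
  have : CompleteSpace E := FiniteDimensional.complete ℂ E
  have hpre : ∀ s, IsPreconnected (h ⁻¹' ball c s) := fun s => by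
    rw [← h.image_symm]
    exact isPreconnected_ball.image _ h.symm.continuous.continuousOn
  have hopen : ∀ s, IsOpen (h ⁻¹' ball c s) := fun s => isOpen_ball.preimage h.continuous
  -- Solutions for different radii agree by uniqueness, so they glue. If the radii were bounded, the
  -- glued solution would live up to the supremum and extend beyond it.
  let T : Set ℝ := {s | r ≤ s ∧ ∃ z, IsSolOn p b g (h ⁻¹' ball c s) z}
  have hrT : r ∈ T := ⟨le_rfl, y, hy⟩
  choose z hz using fun s : T => s.2.2
  have hunion : ∃ w, IsSolOn p b g (⋃ s : T, h ⁻¹' ball c s) w := by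
    refine exists_isSolOn_iUnion (fun s => hopen s) hz fun s t => ?_
    rw [← preimage_inter]
    have key : ∀ s t : T, (s : ℝ) ≤ t → EqOn (z s) (z t) (h ⁻¹' ball c s) := fun s t hst =>
      IsSolOn.eqOn_of_singular hp hinv (hopen s) (hpre s)
        (fun j => ball_subset_ball s.2.1 (hpr j)) (hz s)
        ((hz t).mono (preimage_mono (ball_subset_ball hst)))
    rcases le_total (s : ℝ) t with hst | hst
    · exact (key s t hst).mono (preimage_mono inter_subset_left)
    · exact ((key t s hst).mono (preimage_mono inter_subset_right)).symm
  obtain ⟨w, hw⟩ := hunion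
  by_cases hT : BddAbove T
  · exfalso
    set σ := sSup T with hσ
    have hrσ : r ≤ σ := le_csSup hT hrT
    have hsub : h ⁻¹' ball c σ ⊆ ⋃ s : T, h ⁻¹' ball c s := by
      intro x hx
      obtain ⟨s, hs, hxs⟩ := exists_lt_of_lt_csSup ⟨r, hrT⟩ (mem_ball.1 hx)
      exact mem_iUnion.2 ⟨⟨s, hs⟩, hxs⟩
    obtain ⟨δ, hδ, z', hz'⟩ := exists_isSolOn_preimage_ball_add hg h (hr.trans_le hrσ)
      (fun j => ball_subset_ball hrσ (hpr j)) (hw.mono hsub)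
    have : σ + δ ≤ σ := le_csSup hT ⟨by linarith, z', hz'⟩
    linarith
  · refine ⟨w, hw.mono fun x _ => ?_⟩
    rw [not_bddAbove_iff] at hT
    obtain ⟨s, hs, hxs⟩ := hT (dist (h x) c)
    exact mem_iUnion.2 ⟨⟨s, hs⟩, hxs⟩

end Continuation

/-! ### Polynomial growth of entire functions. -/

section Growth

variable {E : Type*} [NormedAddCommGroup E] [NormedSpace ℂ E]

/-- An entire function of polynomial growth is a polynomial. -/
theorem mem_polyFun_of_norm_le_pow [CompleteSpace E] {f : ℂ → E} (hf : Differentiable ℂ f)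
    {R M : ℝ} {n : ℕ} (hM : ∀ x : ℂ, R ≤ ‖x‖ → ‖f x‖ ≤ M * ‖x‖ ^ n) : f ∈ polyFun E (n + 1) := by
  have hzero : ∀ k, n < k → iteratedDeriv k f 0 = 0 := by
    intro k hk
    -- Cauchy's estimate gives `ρ ^ (n - k)`, at most `ρ⁻¹` because `k > n` and `ρ ≥ 1`.
    have hb : ∀ ρ : ℝ, max R 1 ≤ ρ → ‖iteratedDeriv k f 0‖ ≤ k.factorial * |M| * ρ⁻¹ := by
      intro ρ hρ
      have hρ1 : 1 ≤ ρ := (le_max_right _ _).trans hρ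
      have hρ0 : 0 < ρ := by linarith
      have h1 := Complex.norm_iteratedDeriv_le_of_forall_mem_sphere_norm_le (f := f) (c := 0)
        (R := ρ) (C := |M| * ρ ^ n) k hρ0 hf.diffContOnCl (fun z hz => by
          rw [mem_sphere_zero_iff_norm] at hz
          have := hM z (by rw [hz]; exact (le_max_left _ _).trans hρ)
          rw [hz] at this
          exact this.trans (by gcongr; exact le_abs_self M))
      refine h1.trans ?_
      obtain ⟨e, rfl⟩ : ∃ e, k = n + 1 + e := ⟨k - (n + 1), by omega⟩
      rw [div_le_iff₀ (by positivity), pow_add, pow_succ]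
      have h2 : 1 ≤ ρ ^ e := one_le_pow₀ hρ1
      calc ((n + 1 + e).factorial : ℝ) * (|M| * ρ ^ n)
          ≤ ((n + 1 + e).factorial : ℝ) * (|M| * ρ ^ n) * ρ ^ e :=
            le_mul_of_one_le_right (by positivity) h2
        _ = _ := by field_simp
    have hlim : Tendsto (fun ρ : ℝ => k.factorial * |M| * ρ⁻¹) atTop (𝓝 0) := by
      simpa using tendsto_inv_atTop_zero.const_mul (k.factorial * |M|)
    have := ge_of_tendsto hlim ((eventually_ge_atTop (max R 1)).mono hb)
    exact norm_le_zero_iff.1 this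
  refine ⟨fun k => (k.factorial : ℂ)⁻¹ • iteratedDeriv k f 0, fun x => ?_⟩
  have h1 := Complex.hasSum_taylorSeries_of_entire hf 0 x
  have h2 : HasSum (fun n : ℕ => (n.factorial : ℂ)⁻¹ • (x - 0) ^ n • iteratedDeriv n f 0)
      (∑ k ∈ Finset.range (n + 1), (k.factorial : ℂ)⁻¹ • (x - 0) ^ k • iteratedDeriv k f 0) :=
    hasSum_sum_of_ne_finset_zero (fun k hk => by rw [hzero k (by simpa using hk), smul_zero, smul_zero])
  rw [h1.unique h2]
  exact Finset.sum_congr rfl fun k _ => by rw [sub_zero, smul_comm]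

/-- An entire function satisfying `‖y'‖ ≤ C (‖y‖ + 1) / ‖x‖` near infinity grows polynomially. -/
theorem exists_norm_le_pow_of_norm_deriv_le [FiniteDimensional ℂ E] {y : ℂ → E}
    (hy : Differentiable ℂ y) {R : ℝ} (hR : 1 ≤ R) {n : ℕ} (hn : 0 < n)
    (hbound : ∀ x : ℂ, R ≤ ‖x‖ → ‖x‖ * ‖deriv y x‖ ≤ n * ‖y x‖ + n) :
    ∃ M, ∀ x : ℂ, R ≤ ‖x‖ → ‖y x‖ ≤ M * ‖x‖ ^ n := by
  obtain ⟨M, hM⟩ := (isCompact_sphere (0 : ℂ) R).exists_bound_of_continuousOn hy.continuous.continuousOn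
  refine ⟨M + 1, fun x hx => ?_⟩
  have hR0 : 0 < R := by linarith
  have hx0 : 0 < ‖x‖ := hR0.trans_le hx
  have hxn : (‖x‖ : ℂ) ≠ 0 := by exact_mod_cast hx0.ne'
  -- Gronwall along the ray `t ↦ exp t * e`, where `‖e‖ = R`: in logarithmic time `x d/dx` becomes
  -- `d/dt`, and rate `n` becomes the power `‖x‖ ^ n`.
  set T := Real.log (‖x‖ / R) with hT
  have hT0 : 0 ≤ T := Real.log_nonneg ((one_le_div hR0).2 hx)
  set e : ℂ := (R / ‖x‖ : ℝ) • x with he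
  have hen : ‖e‖ = R := by
    rw [he, norm_smul, Real.norm_of_nonneg (by positivity), div_mul_cancel₀ _ hx0.ne']
  have hM0 : 0 ≤ M := (norm_nonneg _).trans (hM e (by simpa using hen))
  have hnorm : ∀ t : ℝ, ‖(Real.exp t : ℂ) * e‖ = Real.exp t * R := fun t => by
    rw [norm_mul, Complex.norm_real, Real.norm_of_nonneg (Real.exp_pos t).le, hen]
  have hder : ∀ t : ℝ, HasDerivAt (fun t : ℝ => y ((Real.exp t : ℂ) * e))
      (((Real.exp t : ℂ) * e) • deriv y ((Real.exp t : ℂ) * e)) t := by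
    intro t
    have h2 : HasDerivAt (fun t : ℝ => (Real.exp t : ℂ) * e) ((Real.exp t : ℂ) * e) t :=
      (Real.hasDerivAt_exp t).ofReal_comp.mul_const e
    exact (hy _).hasDerivAt.scomp t h2
  have hn0 : (0 : ℝ) < n := by exact_mod_cast hn
  have := norm_le_gronwallBound_of_norm_deriv_right_le (δ := M) (K := n) (ε := n) (a := 0) (b := T)
    (f := fun t : ℝ => y ((Real.exp t : ℂ) * e))
    (fun t _ => (hder t).continuousAt.continuousWithinAt)
    (fun t _ => (hder t).hasDerivWithinAt)
    (by simpa using hM e (by simpa using hen))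
    (fun t ht => by
      rw [norm_smul]
      refine hbound _ ?_
      rw [hnorm]
      have : 1 ≤ Real.exp t := Real.one_le_exp ht.1
      nlinarith) T ⟨hT0, le_rfl⟩
  have hexpT : Real.exp T = ‖x‖ / R := Real.exp_log (by positivity)
  have hend : (Real.exp T : ℂ) * e = x := by
    rw [hexpT, he, Complex.real_smul, Complex.ofReal_div, Complex.ofReal_div]
    have : (R : ℂ) ≠ 0 := by exact_mod_cast hR0.ne'
    field_simp
  rw [hend, sub_zero, gronwallBound_of_K_ne_0 hn0.ne'] at this
  simp only [div_self hn0.ne', one_mul] at this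
  rw [Real.exp_nat_mul, hexpT] at this
  have h3 : (‖x‖ / R) ^ n ≤ ‖x‖ ^ n := by
    gcongr
    exact div_le_self hx0.le hR
  have h4 : 0 ≤ (‖x‖ / R) ^ n := by positivity
  nlinarith

end Growth

/-! ### Uniqueness of the polynomial correction. -/

section Uniqueness

variable {ι E : Type*} [Fintype ι] [DecidableEq ι] [NormedAddCommGroup E] [NormedSpace ℂ E]
  {p : ι → ℂ} {b : ι → E →L[ℂ] E}

/-- Dividing the cleared coefficient by the denominator gives back the partial fractions. -/
theorem inv_prod_smul_fuchsianCoeff_apply {x : ℂ} (hne : ∀ j, x - p j ≠ 0) (v : E) :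
    (∏ j, (x - p j))⁻¹ • fuchsianCoeff p b x v = ∑ j, (x - p j)⁻¹ • b j v := by
  simp only [fuchsianCoeff, _root_.sum_apply, _root_.smul_apply, Finset.smul_sum, smul_smul]
  refine Finset.sum_congr rfl fun j _ => ?_
  rw [← Finset.mul_prod_erase Finset.univ (fun i => x - p i) (Finset.mem_univ j), mul_inv,
    mul_assoc, inv_mul_cancel₀ (Finset.prod_ne_zero_iff.2 fun i _ => hne i), mul_one]

theorem norm_le_of_mem_polyFun {m : ℕ} {φ : ℂ → E} (hφ : φ ∈ polyFun E m) :
    ∃ C, 0 ≤ C ∧ ∀ x : ℂ, 1 ≤ ‖x‖ → ‖φ x‖ ≤ C * ‖x‖ ^ m := by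
  obtain ⟨c, hc⟩ := hφ
  refine ⟨∑ k ∈ Finset.range m, ‖c k‖, Finset.sum_nonneg fun _ _ => norm_nonneg _, fun x hx => ?_⟩
  rw [hc, Finset.sum_mul]
  refine (norm_sum_le _ _).trans (Finset.sum_le_sum fun k hk => ?_)
  rw [norm_smul, norm_pow, mul_comm]
  gcongr
  exact (Finset.mem_range.1 hk).le

/-- Entire solutions of the Fuchsian equation with polynomial right-hand side are polynomials. -/
theorem exists_mem_polyFun_of_fuchsianOp [FiniteDimensional ℂ E] {m : ℕ}
    (hm : Fintype.card ι = m + 1) {y φ : ℂ → E} (hφ : φ ∈ polyFun E m)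
    (hy : IsSolOn p b φ univ y) : ∃ n, y ∈ polyFun E n := by
  have : CompleteSpace E := FiniteDimensional.complete ℂ E
  have hyd : Differentiable ℂ y := differentiableOn_univ.1 hy.1
  obtain ⟨C, hC0, hC⟩ := norm_le_of_mem_polyFun hφ
  set R : ℝ := 1 + ∑ j, 2 * ‖p j‖ with hR
  have hR1 : 1 ≤ R := by
    have : 0 ≤ ∑ j, 2 * ‖p j‖ := Finset.sum_nonneg fun _ _ => by positivity
    linarith
  have hpR : ∀ j, 2 * ‖p j‖ < R := fun j => by
    have := Finset.single_le_sum (f := fun j => 2 * ‖p j‖) (fun _ _ => by positivity)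
      (Finset.mem_univ j)
    linarith
  have hdist : ∀ x : ℂ, R ≤ ‖x‖ → ∀ j, ‖x‖ / 2 ≤ ‖x - p j‖ := fun x hx j => by
    have h1 := norm_sub_norm_le x (p j)
    have h2 := hpR j
    linarith
  -- As `‖x - p j‖ ≥ ‖x‖ / 2` beyond `R`, the first entry bounds `‖x‖ ‖B x‖` and the second bounds
  -- `‖x‖ ‖φ x / Q x‖`.
  obtain ⟨n, hn⟩ := exists_nat_gt (max (∑ j, 2 * ‖b j‖) (C * 2 ^ (m + 1)))
  have hn1 : ∑ j, 2 * ‖b j‖ ≤ n := (le_max_left _ _).trans hn.le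
  have hn2 : C * 2 ^ (m + 1) ≤ n := (le_max_right _ _).trans hn.le
  have hn0 : 0 < n := by
    have : (0 : ℝ) < n := lt_of_le_of_lt (le_max_of_le_right (by positivity)) hn
    exact_mod_cast this
  have hbound : ∀ x : ℂ, R ≤ ‖x‖ → ‖x‖ * ‖deriv y x‖ ≤ n * ‖y x‖ + n := by
    intro x hx
    have hx1 : 1 ≤ ‖x‖ := hR1.trans hx
    have hx0 : 0 < ‖x‖ := by linarith
    have hpos : ∀ j, 0 < ‖x - p j‖ := fun j => (half_pos hx0).trans_le (hdist x hx j)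
    have hne : ∀ j, x - p j ≠ 0 := fun j => norm_pos_iff.1 (hpos j)
    have hQ : (‖x‖ / 2) ^ (m + 1) ≤ ‖∏ j, (x - p j)‖ := by
      rw [norm_prod, ← hm, ← Finset.card_univ, ← Finset.prod_const]
      exact Finset.prod_le_prod (fun _ _ => by positivity) fun j _ => hdist x hx j
    have hφx : ‖x‖ * ‖(∏ j, (x - p j))⁻¹ • φ x‖ ≤ n := by
      rw [norm_smul, norm_inv]
      calc ‖x‖ * (‖∏ j, (x - p j)‖⁻¹ * ‖φ x‖)
          ≤ ‖x‖ * (((‖x‖ / 2) ^ (m + 1))⁻¹ * (C * ‖x‖ ^ m)) := by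
            gcongr
            exact hC x hx1
        _ = C * 2 ^ (m + 1) := by
            rw [div_pow]
            field_simp
            ring
        _ ≤ n := hn2
    have hAx : ‖x‖ * ‖(∏ j, (x - p j))⁻¹ • fuchsianCoeff p b x (y x)‖ ≤ n * ‖y x‖ := by
      rw [inv_prod_smul_fuchsianCoeff_apply hne]
      have h2 : ‖∑ j, (x - p j)⁻¹ • b j (y x)‖ ≤ ∑ j, (‖x‖ / 2)⁻¹ * (‖b j‖ * ‖y x‖) := by
        refine (norm_sum_le _ _).trans (Finset.sum_le_sum fun j _ => ?_)
        rw [norm_smul, norm_inv]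
        gcongr
        · exact hdist x hx j
        · exact (b j).le_opNorm _
      calc _ ≤ ‖x‖ * ∑ j, (‖x‖ / 2)⁻¹ * (‖b j‖ * ‖y x‖) := by gcongr
        _ = (∑ j, 2 * ‖b j‖) * ‖y x‖ := by
            rw [Finset.mul_sum, Finset.sum_mul]
            exact Finset.sum_congr rfl fun j _ => by field_simp
        _ ≤ n * ‖y x‖ := by gcongr
    rw [deriv_eq_of_fuchsianOp (p := p) (b := b) (fun j => sub_ne_zero.1 (hne j)),
      hy.2 x (mem_univ x), smul_sub]
    calc _ ≤ ‖x‖ * (‖(∏ j, (x - p j))⁻¹ • φ x‖ +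
          ‖(∏ j, (x - p j))⁻¹ • fuchsianCoeff p b x (y x)‖) := by
          gcongr; exact norm_sub_le _ _
      _ ≤ _ := by linarith
  obtain ⟨M, hM⟩ := exists_norm_le_pow_of_norm_deriv_le hyd hR1 hn0 hbound
  exact ⟨n + 1, mem_polyFun_of_norm_le_pow hyd hM⟩

/-- A polynomial of low degree in the range of the Fuchsian operator on a connected domain that
contains all singular points vanishes. -/
theorem eq_zero_of_isSolOn_polyFun [FiniteDimensional ℂ E] {m : ℕ}
    (hm : Fintype.card ι = m + 1) (hp : Function.Injective p)
    (hinv : ∀ (k : ℕ) (j : ι), Function.Injective fun v : E => (k : ℂ) • v + b j v)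
    (hinf : ∀ k : ℕ, Function.Injective fun v : E => (k : ℂ) • v + ∑ j, b j v)
    {D : Set ℂ} (hD : IsOpen D) (hDc : IsPreconnected D) (hpD : ∀ j, p j ∈ D)
    {y φ : ℂ → E} (hφ : φ ∈ polyFun E m) (hy : IsSolOn p b φ D y) : φ = 0 := by
  have : Nonempty ι := Fintype.card_pos_iff.1 (by omega)
  obtain ⟨j₀⟩ := this
  have : Nonempty ι := ⟨j₀⟩
  obtain ⟨r, hr, hball⟩ := Metric.isOpen_iff.1 hD (p j₀) (hpD j₀)
  obtain ⟨h, h1, h2⟩ := exists_homeomorph_finset_to_ball hD hDc hr hball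
    (Finset.univ.image p) (by simpa using hpD)
  -- Since `h` fixes the complement of `D`, the preimage of a disc inside `D` stays in `D`, so `y`
  -- is a solution there.
  have hsub : h ⁻¹' ball (p j₀) r ⊆ D := by
    intro x hx
    by_contra hxD
    have hx' : h x ∈ ball (p j₀) r := hx
    rw [h1 x hxD] at hx'
    exact hxD (hball hx')
  obtain ⟨z, hz⟩ := exists_isSolOn_univ hp hinv (differentiable_of_mem_polyFun hφ) h hr
    (fun j => h2 _ (by simp)) (hy.mono hsub)
  obtain ⟨n, hn⟩ := exists_mem_polyFun_of_fuchsianOp hm hφ hz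
  have hLz : fuchsianOp p b z = φ := funext fun x => hz.2 x (mem_univ x)
  have hz0 := eq_zero_of_fuchsianOp_mem_polyFun hm hinf hn (by rw [hLz]; exact hφ)
  rw [← hLz, hz0]
  funext x
  have : deriv (0 : ℂ → E) x = 0 := deriv_const x 0
  simp [fuchsianOp, this]

end Uniqueness

/-! ### Compact sets in a simply connected domain and their hulls. -/

section Hull

/-- There is no continuous logarithm of `x - w` on a circle around `w`. -/
theorem not_exists_continuous_log_on_circle {w : ℂ} {R : ℝ} (hR : 0 < R) {L : ℂ → ℂ}
    (hL : Continuous L) : ¬ ∀ x ∈ sphere w R, Complex.exp (L x) = x - w := by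
  intro h
  set γ : ℝ → ℂ := fun θ => w + R * Complex.exp (θ * Complex.I) with hγ
  have hγc : Continuous γ := by rw [hγ]; fun_prop
  have hγs : ∀ θ, γ θ ∈ sphere w R := fun θ => by
    rw [mem_sphere_iff_norm, hγ]
    simp only [add_sub_cancel_left, norm_mul, Complex.norm_real, Complex.norm_exp_ofReal_mul_I,
      Real.norm_of_nonneg hR.le, mul_one]
  -- Both are lifts of the same loop through the covering `exp`; the right one gains `2πi` over a
  -- turn, while the left one is periodic.
  have heq : (fun θ => L (γ θ)) = fun θ : ℝ => L (γ 0) + θ * Complex.I := by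
    refine Complex.isCoveringMap_exp.eq_of_comp_eq (hL.comp hγc) (by fun_prop) ?_ (0 : ℝ) (by simp)
    funext θ
    simp only [Function.comp_apply, Subtype.mk.injEq]
    rw [Complex.exp_add, h _ (hγs _), h _ (hγs _), hγ]
    simp
  have h1 := congrFun heq (2 * Real.pi)
  have h2 : γ (2 * Real.pi) = γ 0 := by
    simp [hγ, Complex.exp_two_pi_mul_I]
  simp only [h2] at h1
  simp [Real.pi_ne_zero] at h1

/-- In a simply connected plane domain, the bounded components of the complement of a compact set
lie in the domain. -/
theorem mem_of_isBounded_connectedComponentIn {D K : Set ℂ} (hD : IsOpen D)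
    (hDsc : IsSimplyConnected D) (hK : IsCompact K) (hKD : K ⊆ D) {w : ℂ} (hw : w ∈ Kᶜ)
    (hbdd : Bornology.IsBounded (connectedComponentIn Kᶜ w)) : w ∈ D := by
  classical
  by_contra hwD
  set V := connectedComponentIn Kᶜ w with hV
  have hKo : IsOpen Kᶜ := hK.isClosed.isOpen_compl
  have hVo : IsOpen V := hKo.connectedComponentIn
  have hwV : w ∈ V := mem_connectedComponentIn hw
  have hfr : frontier V ⊆ K := by
    intro x hx
    by_contra hxK
    have hxV : x ∈ V := by
      have hpre : IsPreconnected (insert x V) := isPreconnected_connectedComponentIn.subset_closure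
        (subset_insert x V) (insert_subset hx.1 subset_closure)
      exact hpre.subset_connectedComponentIn (mem_insert_of_mem x hwV)
        (insert_subset hxK (connectedComponentIn_subset _ _)) (mem_insert x V)
    exact hx.2 (by rwa [hVo.interior_eq])
  obtain ⟨f, hfc, hf⟩ := Complex.exists_continuousOn_eqOn_exp_comp hDsc hD
    (g := fun x => x - w) (by fun_prop) (by
      rintro ⟨x, hx, hxw⟩
      exact hwD (by rwa [← sub_eq_zero.1 hxw]))
  obtain ⟨F, hF⟩ := ContinuousMap.exists_restrict_eq (Y := ℂ) (isClosed_frontier (s := V))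
    ⟨(frontier V).domRestrict f, (hfc.mono (hfr.trans hKD)).domRestrict⟩
  have hFf : ∀ x ∈ frontier V, F x = f x := fun x hx => by
    have := congrArg (fun G => G ⟨x, hx⟩) hF
    simpa using this
  -- If `w ∉ D`, then `x - w` has a logarithm `f` on `D`, and `F` is a Tietze extension of its
  -- restriction to `frontier V ⊆ K`. The patched function is continuous and zero-free on the plane,
  -- so it has a global logarithm, which on a circle around `V` is a logarithm of `x - w`.
  set G : ℂ → ℂ := fun x => if x ∈ V then Complex.exp (F x) else x - w with hG
  have hGc : Continuous G := by
    refine Continuous.if (fun x hx => ?_) (by fun_prop) (by fun_prop)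
    have hx' : x ∈ frontier V := hx
    rw [hFf x hx']
    exact hf (hKD (hfr hx'))
  have hG0 : (0 : ℂ) ∉ G '' univ := by
    rintro ⟨x, -, hx⟩
    by_cases hxV : x ∈ V
    · rw [hG] at hx
      simp only [if_pos hxV] at hx
      exact Complex.exp_ne_zero _ hx
    · rw [hG] at hx
      simp only [if_neg hxV] at hx
      exact hxV (by rwa [sub_eq_zero.1 hx])
  have huniv : IsSimplyConnected (univ : Set ℂ) := by
    have : ContractibleSpace (univ : Set ℂ) := (Homeomorph.Set.univ ℂ).contractibleSpace
    exact (inferInstance : SimplyConnectedSpace (univ : Set ℂ))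
  obtain ⟨L, hLc, hL⟩ := Complex.exists_continuousOn_eqOn_exp_comp huniv isOpen_univ
    hGc.continuousOn hG0
  obtain ⟨R, hR⟩ := hbdd.subset_ball w
  have hRpos : 0 < R := pos_of_mem_ball (hR hwV)
  refine not_exists_continuous_log_on_circle hRpos (continuousOn_univ.1 hLc) (w := w) fun x hx => ?_
  have hxV : x ∉ V := fun hxV => (mem_ball.1 (hR hxV)).ne (mem_sphere.1 hx)
  have := hL (mem_univ x)
  simpa [hG, hxV] using this

/-- The union of a plane set and the bounded components of its complement. -/
def planeHull (K : Set ℂ) : Set ℂ :=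
  {x | x ∈ Kᶜ → Bornology.IsBounded (connectedComponentIn Kᶜ x)}

theorem subset_planeHull (K : Set ℂ) : K ⊆ planeHull K := fun _ hx hx' => absurd hx hx'

theorem isCompact_planeHull {K : Set ℂ} (hK : IsCompact K) : IsCompact (planeHull K) := by
  refine Metric.isCompact_of_isClosed_isBounded ?_ ?_
  · rw [← isOpen_compl_iff, isOpen_iff_mem_nhds]
    intro x hx
    simp only [planeHull, mem_compl_iff, mem_ofPred_eq, Classical.not_imp] at hx
    have hxK : x ∈ Kᶜ := hx.1
    filter_upwards [hK.isClosed.isOpen_compl.connectedComponentIn.mem_nhds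
      (mem_connectedComponentIn hxK)] with z hz hz'
    refine hx.2 ?_
    rw [connectedComponentIn_eq hz]
    exact hz' (connectedComponentIn_subset _ _ hz)
  · obtain ⟨R, hR⟩ := hK.isBounded.subset_ball (0 : ℂ)
    refine (isBounded_ball (x := (0 : ℂ)) (r := max R 1)).subset fun x hx => ?_
    by_contra hxR
    have hxn : max R 1 ≤ ‖x‖ := by simpa using hxR
    have hx1 : 1 ≤ ‖x‖ := (le_max_right _ _).trans hxn
    -- Outside a disc containing `K` the outward ray avoids `K`, so the component is unbounded.
    have hray : (fun t : ℝ => (t : ℂ) * x) '' Ici 1 ⊆ Kᶜ := by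
      rintro _ ⟨t, ht, rfl⟩ hz
      have h1 := hR hz
      rw [mem_ball_zero_iff, norm_mul, Complex.norm_real, Real.norm_of_nonneg
        (zero_le_one.trans ht)] at h1
      have h2 : R ≤ ‖x‖ := (le_max_left _ _).trans hxn
      have h3 : (1 : ℝ) ≤ t := ht
      nlinarith
    have hmem : x ∈ (fun t : ℝ => (t : ℂ) * x) '' Ici 1 := ⟨1, self_mem_Ici, by simp⟩
    have hb := (hx (hray hmem)).subset ((isPreconnected_Ici.image (fun t : ℝ => (t : ℂ) * x)
      (by fun_prop)).subset_connectedComponentIn hmem hray)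
    obtain ⟨M, hM⟩ := hb.exists_norm_le
    have h1 := hM _ ⟨max 1 (M + 1), mem_Ici.2 (le_max_left _ _), rfl⟩
    rw [norm_mul, Complex.norm_real, Real.norm_of_nonneg (zero_le_one.trans (le_max_left _ _))] at h1
    have h2 : M + 1 ≤ max 1 (M + 1) := le_max_right _ _
    have h3 : 1 ≤ max 1 (M + 1) := le_max_left _ _
    nlinarith

end Hull

/-! ### Pushing poles to infinity. -/

section PolePushing

/-- The Neumann series: `v` is the sum of the powers of `t`, and the algebra is closed. -/
theorem mem_of_mul_one_sub_eq_one {K : Type*} [TopologicalSpace K] [CompactSpace K]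
    {A : Subalgebra ℂ C(K, ℂ)} (hA : IsClosed (A : Set C(K, ℂ))) {t v : C(K, ℂ)} (ht : t ∈ A)
    (ht1 : ‖t‖ < 1) (hv : v * (1 - t) = 1) : v ∈ A := by
  have h1 : v = ∑' n : ℕ, t ^ n := by
    have h2 := mul_neg_geom_series t ht1
    calc v = v * ((1 - t) * ∑' n : ℕ, t ^ n) := by rw [h2, mul_one]
      _ = ∑' n : ℕ, t ^ n := by rw [← mul_assoc, hv, one_mul]
  rw [h1]
  have hs : HasSum (fun n : ℕ => t ^ n) (∑' n : ℕ, t ^ n) :=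
    (summable_geometric_of_norm_lt_one ht1).hasSum
  exact hA.mem_of_tendsto hs (Eventually.of_forall fun s => A.sum_mem fun n _ => A.pow_mem ht n)

/-- Simple fractions with pole in an unbounded component of the complement of `K` are uniform
limits of polynomials on `K`. -/
theorem exists_mem_closure_polynomialFunctions {K : Set ℂ} (hK : IsCompact K) {w : ℂ}
    (hw : w ∈ Kᶜ) (hunb : ¬ Bornology.IsBounded (connectedComponentIn Kᶜ w)) :
    ∃ k ∈ closure (polynomialFunctions K : Set C(K, ℂ)), ∀ x : K, k x = (w - x)⁻¹ := by
  have : CompactSpace K := isCompact_iff_compactSpace.1 hK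
  set A := (polynomialFunctions K).topologicalClosure with hA
  have hAc : IsClosed (A : Set C(K, ℂ)) := Subalgebra.isClosed_topologicalClosure _
  have hAcoe : (A : Set C(K, ℂ)) = closure (polynomialFunctions K : Set C(K, ℂ)) :=
    Subalgebra.topologicalClosure_coe _
  have hX : (⟨fun x : K => (x : ℂ), by fun_prop⟩ : C(K, ℂ)) ∈ A := by
    refine Subalgebra.le_topologicalClosure _ ?_
    rw [← SetLike.mem_coe, polynomialFunctions_coe]
    exact ⟨X, by ext x; simp⟩
  set S : Set ℂ := {z | z ∈ Kᶜ ∧ ∃ k ∈ A, ∀ x : K, k x = (z - x)⁻¹} with hS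
  have hne : ∀ z ∈ Kᶜ, ∀ x : K, z - x ≠ 0 := fun z hz x h => hz (by
    rw [sub_eq_zero.1 h]; exact x.2)
  -- the pole can be moved by less than its distance to `K`
  have hmove : ∀ z ∈ S, ∀ z' ∈ Kᶜ, ∀ d > 0, (∀ x : K, d ≤ ‖z - x‖) → ‖z' - z‖ ≤ d / 2 →
      z' ∈ S := by
    rintro z ⟨hz, k, hkA, hk⟩ z' hz' d hd hdist hzz
    refine ⟨hz', ?_⟩
    -- `z' - x = (z - x) (1 - t)` with `‖t‖ ≤ 1 / 2`, so `1 / (z' - x)` is `k` times a Neumann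
    -- series in `k`.
    set t : C(K, ℂ) := (-(z' - z)) • k with ht
    have htA : t ∈ A := A.smul_mem hkA _
    have ht1 : ‖t‖ < 1 := by
      refine lt_of_le_of_lt ?_ (by norm_num : (1 / 2 : ℝ) < 1)
      rw [ContinuousMap.norm_le _ (by norm_num)]
      intro x
      rw [ht, ContinuousMap.smul_apply, hk, norm_smul, norm_neg, norm_inv]
      have h0 : 0 < ‖z - x‖ := hd.trans_le (hdist x)
      rw [← div_eq_mul_inv, div_le_iff₀ h0]
      linarith [hdist x]
    have hvA : (⟨fun x : K => (z - x) * (z' - x)⁻¹, by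
        refine Continuous.mul (by fun_prop) (Continuous.inv₀ (by fun_prop) (hne z' hz'))⟩ :
        C(K, ℂ)) ∈ A := by
      refine mem_of_mul_one_sub_eq_one hAc htA ht1 ?_
      ext x
      simp only [ContinuousMap.mul_apply, ContinuousMap.coe_mk, ContinuousMap.sub_apply,
        ContinuousMap.one_apply, ht, ContinuousMap.smul_apply, hk, smul_eq_mul]
      have h1 := hne z hz x
      have h2 := hne z' hz' x
      field_simp
      ring
    refine ⟨k * _, A.mul_mem hkA hvA, fun x => ?_⟩
    simp only [ContinuousMap.mul_apply, ContinuousMap.coe_mk, hk]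
    rw [← mul_assoc, inv_mul_cancel₀ (hne z hz x), one_mul]
  have hgap : ∀ z ∈ Kᶜ, ∃ d > 0, ∀ x ∈ K, d ≤ ‖z - x‖ := by
    intro z hz
    obtain ⟨d, hd, hdK⟩ := Metric.isOpen_iff.1 hK.isClosed.isOpen_compl z hz
    refine ⟨d, hd, fun x hx => ?_⟩
    by_contra! h
    exact hdK (by rwa [mem_ball, dist_eq_norm, norm_sub_rev]) hx
  have hSo : IsOpen S := by
    rw [Metric.isOpen_iff]
    intro z hz
    obtain ⟨d, hd, hdK⟩ := hgap z hz.1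
    refine ⟨d / 2, half_pos hd, fun z' hz' => ?_⟩
    rw [mem_ball, dist_eq_norm] at hz'
    refine hmove z hz z' (fun hz'K => ?_) d hd (fun x => hdK x x.2) hz'.le
    have := hdK z' hz'K
    rw [norm_sub_rev] at this
    linarith
  have hCS : connectedComponentIn Kᶜ w ⊆ S := by
    refine isPreconnected_connectedComponentIn.subset_of_closure_inter_subset hSo ?_ ?_
    · obtain ⟨R, hR⟩ := hK.isBounded.exists_norm_le
      obtain ⟨z, hz, hzR⟩ : ∃ z ∈ connectedComponentIn Kᶜ w, max R 0 + 1 < ‖z‖ := by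
        by_contra! h
        exact hunb (isBounded_iff_forall_norm_le.2 ⟨_, h⟩)
      have hzK : z ∈ Kᶜ := connectedComponentIn_subset _ _ hz
      refine ⟨z, hz, hzK, ?_⟩
      have hR0 : 0 ≤ max R 0 := le_max_right _ _
      have hz0 : z ≠ 0 := norm_pos_iff.1 (by linarith)
      -- For a pole far away, `1 / (z - x) = z⁻¹ (1 - x / z)⁻¹` expands in powers of `x`.
      set t : C(K, ℂ) := z⁻¹ • ⟨fun x : K => (x : ℂ), by fun_prop⟩ with ht
      have htA : t ∈ A := A.smul_mem hX _
      have ht1 : ‖t‖ < 1 := by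
        have hzn : 0 < ‖z‖ := norm_pos_iff.2 hz0
        refine lt_of_le_of_lt (b := max R 0 / ‖z‖) ?_ (by rw [div_lt_one hzn]; linarith)
        rw [ContinuousMap.norm_le _ (by positivity)]
        intro x
        rw [ht, ContinuousMap.smul_apply, norm_smul, norm_inv, ContinuousMap.coe_mk,
          div_eq_inv_mul]
        gcongr
        exact (hR x x.2).trans (le_max_left _ _)
      have hvA : (⟨fun x : K => z * (z - x)⁻¹, by
          refine Continuous.mul (by fun_prop) (Continuous.inv₀ (by fun_prop) (hne z hzK))⟩ :
          C(K, ℂ)) ∈ A := by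
        refine mem_of_mul_one_sub_eq_one hAc htA ht1 ?_
        ext x
        simp only [ContinuousMap.mul_apply, ContinuousMap.coe_mk, ContinuousMap.sub_apply,
          ContinuousMap.one_apply, ht, ContinuousMap.smul_apply, smul_eq_mul]
        have h1 := hne z hzK x
        field_simp
      refine ⟨z⁻¹ • _, A.smul_mem hvA _, fun x => ?_⟩
      simp only [ContinuousMap.smul_apply, ContinuousMap.coe_mk, smul_eq_mul]
      rw [← mul_assoc, inv_mul_cancel₀ hz0, one_mul]
    · rintro z ⟨hz, hzC⟩
      have hzK : z ∈ Kᶜ := connectedComponentIn_subset _ _ hzC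
      obtain ⟨d, hd, hdK⟩ := hgap z hzK
      -- With `d / 4`, the point `z'` is still at distance at least `d / 2` from `K`, and moving
      -- back to `z` is within half of that.
      obtain ⟨z', hz', hzz⟩ := Metric.mem_closure_iff.1 hz (d / 4) (by positivity)
      rw [dist_eq_norm] at hzz
      refine hmove z' hz' z hzK (d / 2) (half_pos hd) (fun x => ?_) (by linarith)
      have h1 := hdK x x.2
      have h2 : ‖z - x‖ ≤ ‖z - z'‖ + ‖z' - x‖ := norm_sub_le_norm_sub_add_norm_sub _ _ _
      linarith
  obtain ⟨-, k, hk, hkx⟩ := hCS (mem_connectedComponentIn hw)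
  exact ⟨k, by rw [← hAcoe]; exact hk, hkx⟩

end PolePushing

/-! ### The Cauchy–Pompeiu formula. -/

section CauchyPompeiu

open MeasureTheory

/-- The Wirtinger derivative `∂u/∂z̄`. -/
noncomputable def dbar (u : ℂ → ℂ) (z : ℂ) : ℂ :=
  (1 / 2) * (fderiv ℝ u z 1 + Complex.I * fderiv ℝ u z Complex.I)

theorem dbar_eq_zero_of_differentiableAt {u : ℂ → ℂ} {z : ℂ} (hu : DifferentiableAt ℂ u z) :
    dbar u z = 0 := by
  have h : fderiv ℝ u z = (fderiv ℂ u z).restrictScalars ℝ :=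
    hu.fderiv_restrictScalars ℝ
  have h1 : fderiv ℂ u z Complex.I = Complex.I * fderiv ℂ u z 1 := by
    rw [← smul_eq_mul, ← map_smul, smul_eq_mul, mul_one]
  rw [dbar, h]
  simp only [ContinuousLinearMap.coe_restrictScalars', h1]
  rw [← mul_assoc, Complex.I_mul_I]
  ring

theorem continuous_dbar {u : ℂ → ℂ} (hu : ContDiff ℝ 1 u) : Continuous (dbar u) := by
  have := hu.continuous_fderiv one_ne_zero
  unfold dbar
  fun_prop

theorem dbar_congr {u v : ℂ → ℂ} {z : ℂ} (h : u =ᶠ[𝓝 z] v) : dbar u z = dbar v z := by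
  rw [dbar, dbar, h.fderiv_eq]

/-- The **Cauchy–Pompeiu formula** for compactly supported functions. -/
theorem integral_dbar_div {u : ℂ → ℂ} (hu : ContDiff ℝ 1 u) (hc : HasCompactSupport u) (x : ℂ) :
    ∫ w, dbar u w * (w - x)⁻¹ = -(Real.pi * u x) := by
  set e : ℝ → ℂ := fun θ => Real.cos θ + Real.sin θ * Complex.I with he
  have hec : Continuous e := by rw [he]; fun_prop
  have hen : ∀ θ, ‖e θ‖ = 1 := fun θ => by
    have : e θ = Complex.exp (θ * Complex.I) := by
      rw [Complex.exp_mul_I, he]; simp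
    rw [this, Complex.norm_exp_ofReal_mul_I]
  have hder : ∀ θ, HasDerivAt e (Complex.I * e θ) θ := fun θ => by
    have h1 := (Real.hasDerivAt_cos θ).ofReal_comp
    have h2 := (Real.hasDerivAt_sin θ).ofReal_comp.mul_const Complex.I
    refine (h1.add h2).congr_deriv ?_
    rw [he]
    push_cast
    linear_combination (-(Complex.sin θ)) * Complex.I_mul_I
  set P : ℝ × ℝ → ℂ := fun q => x + q.1 * e q.2 with hP
  have hPc : Continuous P := by rw [hP]; fun_prop
  set T₁ : ℝ × ℝ → ℂ := fun q => fderiv ℝ u (P q) (e q.2) with hT₁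
  set T₂ : ℝ × ℝ → ℂ := fun q => fderiv ℝ u (P q) (Complex.I * e q.2) with hT₂
  have hfc := hu.continuous_fderiv one_ne_zero
  have hT₁c : Continuous T₁ := by rw [hT₁]; fun_prop
  have hT₂c : Continuous T₂ := by rw [hT₂]; fun_prop
  -- polar coordinates
  have hpolar : ∫ w, dbar u w * (w - x)⁻¹ =
      ∫ q in Ioi (0 : ℝ) ×ˢ Ioo (-Real.pi) Real.pi, (1 / 2 : ℂ) * (T₁ q + Complex.I * T₂ q) := by
    rw [← integral_add_left_eq_self _ x, ← Complex.integral_comp_polarCoord_symm]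
    refine setIntegral_congr_fun (measurableSet_Ioi.prod measurableSet_Ioo) fun q hq => ?_
    have hq0 : (q.1 : ℂ) ≠ 0 := by
      have : (0 : ℝ) < q.1 := hq.1
      exact_mod_cast this.ne'
    have he0 : e q.2 ≠ 0 := norm_pos_iff.1 (by rw [hen]; exact one_pos)
    -- Passing to the rotated frame `e, i e` produces the factor `e`; with the Jacobian `r` it
    -- cancels `w - x = r e`, so the singularity disappears.
    have hlin : fderiv ℝ u (P q) 1 + Complex.I * fderiv ℝ u (P q) Complex.I =
        e q.2 * (T₁ q + Complex.I * T₂ q) := by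
      have h1 : e q.2 = Real.cos q.2 • (1 : ℂ) + Real.sin q.2 • Complex.I := by
        simp [he]
      have h2 : Complex.I * e q.2 = (-Real.sin q.2) • (1 : ℂ) + Real.cos q.2 • Complex.I := by
        simp only [he, Complex.real_smul]
        push_cast
        linear_combination (Complex.sin q.2) * Complex.I_mul_I
      have h3 : T₁ q = Real.cos q.2 • fderiv ℝ u (P q) 1 +
          Real.sin q.2 • fderiv ℝ u (P q) Complex.I := by
        rw [hT₁]; simp only; rw [h1, map_add, map_smul, map_smul]
      have h4 : T₂ q = (-Real.sin q.2) • fderiv ℝ u (P q) 1 +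
          Real.cos q.2 • fderiv ℝ u (P q) Complex.I := by
        rw [hT₂]; simp only; rw [h2, map_add, map_smul, map_smul]
      have h5 : (Real.cos q.2 : ℂ) ^ 2 + (Real.sin q.2 : ℂ) ^ 2 = 1 := by
        exact_mod_cast Real.cos_sq_add_sin_sq q.2
      rw [h3, h4]
      simp only [he, Complex.real_smul]
      push_cast at h5 ⊢
      linear_combination (-(fderiv ℝ u (P q) 1) - Complex.I * (fderiv ℝ u (P q) Complex.I)) * h5 +
        ((Complex.sin q.2) ^ 2 * (fderiv ℝ u (P q) 1)
          - (Complex.sin q.2) * (Complex.cos q.2) * (fderiv ℝ u (P q) Complex.I)) *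
          Complex.I_mul_I
    have hsymm : x + Complex.polarCoord.symm q = P q := by
      rw [Complex.polarCoord_symm_apply]
    rw [hsymm, dbar, hlin, hP, add_sub_cancel_left, Complex.real_smul]
    field_simp
  -- integrability
  obtain ⟨ρ, hρ⟩ := hc.isCompact.isBounded.subset_closedBall x
  have hvan : ∀ q : ℝ × ℝ, ρ < |q.1| → fderiv ℝ u (P q) = 0 := by
    intro q hq
    have : P q ∉ tsupport u := fun h => by
      have h1 := hρ h
      rw [mem_closedBall_iff_norm, hP, add_sub_cancel_left, norm_mul, hen, mul_one,
        Complex.norm_real, Real.norm_eq_abs] at h1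
      exact absurd h1 (not_le.2 hq)
    exact image_eq_zero_of_notMem_tsupport fun h => this (tsupport_fderiv_subset ℝ h)
  have hint : ∀ F : ℝ × ℝ → ℂ, Continuous F → (∀ q : ℝ × ℝ, ρ < |q.1| → F q = 0) →
      IntegrableOn F (Ioi (0 : ℝ) ×ˢ Ioo (-Real.pi) Real.pi) := by
    intro F hF hF0
    have h1 : IntegrableOn F (Icc 0 ρ ×ˢ Icc (-Real.pi) Real.pi) :=
      hF.continuousOn.integrableOn_compact (isCompact_Icc.prod isCompact_Icc)
    have h2 : IntegrableOn F (Ioi ρ ×ˢ Icc (-Real.pi) Real.pi) := by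
      refine integrableOn_zero.congr_fun (fun q hq => ?_) (measurableSet_Ioi.prod measurableSet_Icc)
      exact (hF0 q (lt_of_lt_of_le hq.1 (le_abs_self _))).symm
    refine (h1.union h2).mono_set fun q hq => ?_
    rcases le_or_gt q.1 ρ with h | h
    · exact Or.inl ⟨⟨hq.1.le, h⟩, Ioo_subset_Icc_self hq.2⟩
    · exact Or.inr ⟨h, Ioo_subset_Icc_self hq.2⟩
  have hT₁i := hint T₁ hT₁c fun q hq => by simp only [hT₁, hvan q hq, _root_.zero_apply]
  have hT₂i := hint T₂ hT₂c fun q hq => by simp only [hT₂, hvan q hq, _root_.zero_apply]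
  -- the radial part
  have hI₁ : ∫ q in Ioi (0 : ℝ) ×ˢ Ioo (-Real.pi) Real.pi, T₁ q = -(2 * Real.pi * u x) := by
    have hT₁i' := hT₁i
    rw [IntegrableOn, Measure.volume_eq_prod, ← Measure.prod_restrict] at hT₁i'
    rw [Measure.volume_eq_prod, ← Measure.prod_restrict, integral_prod_symm _ hT₁i']
    have hinner : ∀ θ : ℝ, ∫ r in Ioi (0 : ℝ), T₁ (r, θ) = -u x := by
      intro θ
      have hd : ∀ r : ℝ, HasDerivAt (fun r : ℝ => u (x + r * e θ)) (T₁ (r, θ)) r := fun r => by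
        have h2 : HasDerivAt (fun r : ℝ => x + (r : ℂ) * e θ) (e θ) r := by
          simpa using (Complex.ofRealCLM.hasDerivAt (x := r)).mul_const (e θ) |>.const_add x
        exact ((hu.differentiable one_ne_zero _).hasFDerivAt).comp_hasDerivAt r h2
      have hcd : ContDiff ℝ 1 (fun r : ℝ => u (x + r * e θ)) := by
        refine hu.comp (contDiff_const.add (ContDiff.mul ?_ contDiff_const))
        exact Complex.ofRealCLM.contDiff
      have hcs : HasCompactSupport (fun r : ℝ => u (x + r * e θ)) := by
        refine HasCompactSupport.of_support_subset_isCompact (isCompact_Icc (a := -ρ) (b := ρ))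
          fun r hr => ?_
        have h1 := hρ (subset_tsupport u hr)
        rw [mem_closedBall_iff_norm, add_sub_cancel_left, norm_mul, hen, mul_one,
          Complex.norm_real, Real.norm_eq_abs] at h1
        exact abs_le.1 h1
      have := hcs.integral_Ioi_deriv_eq hcd 0
      simp only [(hd _).deriv] at this
      simpa using this
    simp only [hinner]
    rw [setIntegral_const]
    simp only [Measure.real, Real.volume_Ioo, Complex.real_smul]
    rw [ENNReal.toReal_ofReal (by linarith [Real.pi_pos])]
    push_cast
    ring
  -- the angular part
  have hI₂ : ∫ q in Ioi (0 : ℝ) ×ˢ Ioo (-Real.pi) Real.pi, T₂ q = 0 := by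
    have hT₂i' := hT₂i
    rw [Measure.volume_eq_prod] at hT₂i' ⊢
    rw [setIntegral_prod _ hT₂i']
    refine setIntegral_eq_zero_of_forall_eq_zero fun r hr => ?_
    have hr0 : (r : ℂ) ≠ 0 := by
      have : (0 : ℝ) < r := hr
      exact_mod_cast this.ne'
    have hd : ∀ θ : ℝ, HasDerivAt (fun θ : ℝ => (r : ℂ)⁻¹ * u (x + r * e θ)) (T₂ (r, θ)) θ := by
      intro θ
      have h2 : HasDerivAt (fun θ : ℝ => x + (r : ℂ) * e θ) (r • (Complex.I * e θ)) θ := by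
        simpa using ((hder θ).const_mul (r : ℂ)).const_add x
      have h3 := ((hu.differentiable one_ne_zero (x + r * e θ)).hasFDerivAt).comp_hasDerivAt θ h2
      refine (h3.const_mul ((r : ℂ)⁻¹)).congr_deriv ?_
      rw [map_smul, Complex.real_smul, ← mul_assoc, inv_mul_cancel₀ hr0, one_mul]
    have hpi : -Real.pi ≤ Real.pi := by linarith [Real.pi_pos]
    rw [← integral_Ioc_eq_integral_Ioo, ← intervalIntegral.integral_of_le hpi,
      intervalIntegral.integral_eq_sub_of_hasDerivAt (fun θ _ => hd θ)
        ((hT₂c.comp (by fun_prop : Continuous fun θ : ℝ => (r, θ))).intervalIntegrable _ _)]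
    simp [he]
  rw [hpolar, integral_const_mul, integral_add hT₁i (hT₂i.const_mul _), integral_const_mul, hI₁,
    hI₂]
  ring

end CauchyPompeiu

/-! ### Runge approximation. -/

section Runge

open MeasureTheory

/-- **Runge's theorem** for simply connected domains. -/
theorem exists_polynomial_near {D : Set ℂ} (hD : IsOpen D) (hDsc : IsSimplyConnected D) {f : ℂ → ℂ}
    (hf : DifferentiableOn ℂ f D) {K : Set ℂ} (hK : IsCompact K) (hKD : K ⊆ D) {ε : ℝ}
    (hε : 0 < ε) : ∃ q : ℂ[X], ∀ x ∈ K, ‖f x - q.eval x‖ < ε := by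
  have : CompactSpace K := isCompact_iff_compactSpace.1 hK
  have hhull : planeHull K ⊆ D := fun x hx => by
    by_cases hxK : x ∈ K
    · exact hKD hxK
    · exact mem_of_isBounded_connectedComponentIn hD hDsc hK hKD hxK (hx hxK)
  obtain ⟨L, hLc, hKL, hLD⟩ := exists_compact_between (isCompact_planeHull hK) hD hhull
  obtain ⟨χ, hχ1, hχ0, -⟩ := exists_contMDiffMap_one_nhds_of_subset_interior (n := 1)
    (modelWithCornersSelf ℝ ℂ) (isCompact_planeHull hK).isClosed hKL
  have hχd : ContDiff ℝ 1 (χ : ℂ → ℝ) := χ.contMDiff.contDiff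
  have hχsupp : tsupport (χ : ℂ → ℝ) ⊆ L := closure_minimal
    (fun x hx => by_contra fun h => hx (hχ0 x h)) hLc.isClosed
  -- On `K`, `f = u` is an integral of `dbar u w / (w - x)`. As `dbar u` vanishes near the hull,
  -- every pole that contributes can be pushed to infinity.
  set u : ℂ → ℂ := fun x => (χ x : ℂ) * f x with hu
  have husupp : tsupport u ⊆ L := closure_minimal
    (fun x hx => by_contra fun h => hx (by simp [hu, hχ0 x h])) hLc.isClosed
  have huc : HasCompactSupport u := HasCompactSupport.of_support_subset_isCompact hLc
    ((subset_tsupport u).trans husupp)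
  have hud : ContDiff ℝ 1 u := by
    rw [contDiff_iff_contDiffAt]
    intro x
    by_cases hx : x ∈ D
    · have h1 : ContDiffAt ℝ 1 f x :=
        ((hf.analyticAt (hD.mem_nhds hx)).contDiffAt (n := 1)).restrict_scalars ℝ
      exact ((Complex.ofRealCLM.contDiff.comp hχd).contDiffAt).mul h1
    · have h1 : u =ᶠ[𝓝 x] fun _ => 0 := by
        filter_upwards [hLc.isClosed.isOpen_compl.mem_nhds fun h => hx (hLD h)] with z hz
        simp [hu, hχ0 z hz]
      exact contDiffAt_const.congr_of_eventuallyEq h1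
  have hχnear : ∀ x ∈ planeHull K, ∀ᶠ z in 𝓝 x, χ z = 1 := fun x hx =>
    hχ1.filter_mono (nhds_le_nhdsSet hx)
  have hnear : ∀ x ∈ planeHull K, ∀ᶠ z in 𝓝 x, dbar u z = 0 := by
    intro x hx
    filter_upwards [eventually_eventually_nhds.2 (hχnear x hx), hD.mem_nhds (hhull hx)] with z hz hzD
    have h1 : u =ᶠ[𝓝 z] f := by
      filter_upwards [hz] with w hw
      simp [hu, hw]
    rw [dbar_congr h1]
    exact dbar_eq_zero_of_differentiableAt ((hf z hzD).differentiableAt (hD.mem_nhds hzD))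
  have hdc := continuous_dbar hud
  have hdsupp : ∀ w ∉ L, dbar u w = 0 := fun w hw => by
    have h1 : u =ᶠ[𝓝 w] fun _ => 0 := by
      filter_upwards [hLc.isClosed.isOpen_compl.mem_nhds hw] with z hz
      simp [hu, hχ0 z hz]
    rw [dbar_congr h1]
    simp [dbar]
  set J : C(ℂ × K, ℂ) := ⟨fun q => dbar u q.1 * (q.1 - q.2)⁻¹, by
    rw [continuous_iff_continuousAt]
    rintro ⟨w, x⟩
    by_cases hwx : w - x = 0
    · have hwK : w ∈ planeHull K := subset_planeHull K (by rw [sub_eq_zero.1 hwx]; exact x.2)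
      have h1 : (fun q : ℂ × K => dbar u q.1 * (q.1 - q.2)⁻¹) =ᶠ[𝓝 (w, x)] fun _ => 0 := by
        filter_upwards [continuousAt_fst.eventually (hnear w hwK)] with q hq
        simp [hq]
      exact continuousAt_const.congr h1.symm
    · exact ContinuousAt.mul (by fun_prop) (ContinuousAt.inv₀ (by fun_prop) hwx)⟩ with hJ
  set Ψ : C(ℂ, C(K, ℂ)) := J.curry with hΨ
  have hΨx : ∀ w (x : K), Ψ w x = dbar u w * (w - x)⁻¹ := fun w x => rfl
  set A := (polynomialFunctions K).topologicalClosure with hA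
  have hAc : IsClosed (A : Set C(K, ℂ)) := Subalgebra.isClosed_topologicalClosure _
  have hAcoe : (A : Set C(K, ℂ)) = closure (polynomialFunctions K : Set C(K, ℂ)) :=
    Subalgebra.topologicalClosure_coe _
  have hΨA : ∀ w, Ψ w ∈ A := by
    intro w
    by_cases hw : w ∈ planeHull K
    · have : Ψ w = 0 := by
        ext x
        rw [hΨx, (hnear w hw).self_of_nhds]
        simp
      rw [this]
      exact A.zero_mem
    · simp only [planeHull, mem_ofPred_eq, Classical.not_imp] at hw
      obtain ⟨k, hk, hkx⟩ := exists_mem_closure_polynomialFunctions hK hw.1 hw.2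
      have : Ψ w = dbar u w • k := by
        ext x
        rw [hΨx, ContinuousMap.smul_apply, hkx, smul_eq_mul]
      rw [this]
      exact A.smul_mem (by rw [← SetLike.mem_coe, hAcoe]; exact hk) _
  have hΨsupp : HasCompactSupport Ψ := HasCompactSupport.of_support_subset_isCompact hLc
    fun w hw => by
      by_contra h
      exact hw (by ext x; rw [hΨx, hdsupp w h]; simp)
  have hΨint : Integrable Ψ := Ψ.continuous.integrable_of_hasCompactSupport hΨsupp
  -- Integrating inside the complete subspace `A` shows that the `C(K, ℂ)`-valued integral stays in
  -- `A`.
  set Ψ' : ℂ → A.toSubmodule := fun w => ⟨Ψ w, hΨA w⟩ with hΨ'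
  have hΨ'c : Continuous Ψ' := Ψ.continuous.subtype_mk hΨA
  have hΨ'supp : HasCompactSupport Ψ' := HasCompactSupport.of_support_subset_isCompact hLc
    fun w hw => by
      by_contra h
      exact hw (Subtype.ext (by ext x; change Ψ w x = 0; rw [hΨx, hdsupp w h]; simp))
  have hΨ'int : Integrable Ψ' := hΨ'c.integrable_of_hasCompactSupport hΨ'supp
  have : CompleteSpace A.toSubmodule := hAc.completeSpace_coe
  have hmem : ∫ w, Ψ w ∈ A := by
    have h1 := (A.toSubmodule.subtypeL).integral_comp_comm hΨ'int
    have h2 : (∫ w, Ψ w) = ((∫ w, Ψ' w : A.toSubmodule) : C(K, ℂ)) := h1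
    rw [h2]
    exact (∫ w, Ψ' w : A.toSubmodule).2
  have hval : ∀ x : K, (∫ w, Ψ w) x = -(Real.pi * f x) := by
    intro x
    have h1 := (ContinuousMap.evalCLM ℂ x).integral_comp_comm hΨint
    have h2 : (∫ w, Ψ w) x = ∫ w, Ψ w x := h1.symm
    have h3 : u x = f x := by
      simp [hu, (hχnear x (subset_planeHull K x.2)).self_of_nhds]
    rw [h2, ← h3]
    exact integral_dbar_div hud huc x
  have hfin : (-(Real.pi : ℂ)⁻¹) • (∫ w, Ψ w) ∈ closure (polynomialFunctions K : Set C(K, ℂ)) := by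
    rw [← hAcoe]
    exact A.smul_mem hmem _
  obtain ⟨P, hP, hPd⟩ := Metric.mem_closure_iff.1 hfin ε hε
  rw [polynomialFunctions_coe] at hP
  obtain ⟨q, rfl⟩ := hP
  refine ⟨q, fun x hx => ?_⟩
  have h1 := ContinuousMap.dist_apply_le_dist (f := (-(Real.pi : ℂ)⁻¹) • (∫ w, Ψ w))
    (g := Polynomial.toContinuousMapOnAlgHom K q) ⟨x, hx⟩
  rw [ContinuousMap.smul_apply, hval, dist_eq_norm] at h1
  have hpi : (Real.pi : ℂ) ≠ 0 := by exact_mod_cast Real.pi_ne_zero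
  have h2 : (-(Real.pi : ℂ)⁻¹) • (-(Real.pi * f x)) = f x := by
    rw [smul_eq_mul]
    field_simp
  simp only [h2] at h1
  exact lt_of_le_of_lt (by simpa using h1) hPd

end Runge

/-! ### Existence by approximation and compactness. -/

section Existence

/-- For a continuous limit, locally uniform convergence is a joint limit in index and point, so sums
and products follow from `Tendsto` calculus. -/
theorem tendstoLocallyUniformlyOn_iff_forall_tendsto_nhds {X Y κ : Type*} [TopologicalSpace X]
    [UniformSpace Y] {l : Filter κ} {F : κ → X → Y} {f : X → Y} {s : Set X}
    (hf : ContinuousOn f s) : TendstoLocallyUniformlyOn F f l s ↔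
      ∀ x ∈ s, Tendsto (fun q : κ × X => F q.1 q.2) (l ×ˢ 𝓝[s] x) (𝓝 (f x)) := by
  rw [tendstoLocallyUniformlyOn_iff_forall_tendsto]
  refine forall₂_congr fun x hx => ?_
  have h1 : Tendsto (fun q : κ × X => f q.2) (l ×ˢ 𝓝[s] x) (𝓝 (f x)) :=
    Tendsto.comp (hf x hx) tendsto_snd
  exact ⟨fun h => h1.congr_uniformity h, fun h =>
    (h1.prodMk_nhds h).mono_right (nhds_le_uniformity (f x))⟩

variable {E : Type*} [NormedAddCommGroup E] [NormedSpace ℂ E]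

/-- The polynomial function with coefficients `c 0, …, c (m - 1)`. -/
def polyOfCoeff {m : ℕ} (c : Fin m → E) (x : ℂ) : E := ∑ k : Fin m, x ^ (k : ℕ) • c k

theorem mem_polyFun_iff_exists_polyOfCoeff {m : ℕ} {φ : ℂ → E} :
    φ ∈ polyFun E m ↔ ∃ c : Fin m → E, φ = polyOfCoeff c := by
  constructor
  · rintro ⟨c, hc⟩
    exact ⟨fun k => c k, funext fun x => by
      rw [hc, polyOfCoeff, Fin.sum_univ_eq_sum_range (fun k => x ^ k • c k)]⟩
  · rintro ⟨c, rfl⟩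
    exact ⟨fun k => if h : k < m then c ⟨k, h⟩ else 0, fun x => by
      rw [polyOfCoeff, ← Fin.sum_univ_eq_sum_range
        (fun k => x ^ k • (if h : k < m then c ⟨k, h⟩ else 0))]
      simp⟩

theorem eq_zero_of_polyOfCoeff_eq_zero {m : ℕ} {c : Fin m → E}
    (h : ∀ x, polyOfCoeff c x = 0) : c = 0 := by
  induction m with
  | zero => exact Subsingleton.elim _ _
  | succ m ih =>
    have hsum : ∀ x, polyOfCoeff (fun k : Fin m => c k.castSucc) x + x ^ m • c (Fin.last m) = 0 :=
      fun x => by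
        have := h x
        rwa [polyOfCoeff, Fin.sum_univ_castSucc] at this
    have hlast : c (Fin.last m) = 0 := by
      refine eq_zero_of_pow_smul_mem_polyFun (n := m) ?_
      have h1 := (polyFun E m).neg_mem
        (mem_polyFun_iff_exists_polyOfCoeff.2 ⟨fun k : Fin m => c k.castSucc, rfl⟩)
      convert h1 using 1
      funext x
      exact eq_neg_of_add_eq_zero_right (hsum x)
    have hrest := ih (c := fun k : Fin m => c k.castSucc) fun x => by simpa [hlast] using hsum x
    funext k
    refine Fin.lastCases hlast (fun k => congrFun hrest k) k

theorem polyOfCoeff_smul {m : ℕ} (a : ℂ) (c : Fin m → E) (x : ℂ) :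
    polyOfCoeff (a • c) x = a • polyOfCoeff c x := by
  simp [polyOfCoeff, Finset.smul_sum, smul_comm a]

theorem tendsto_polyOfCoeff {κ : Type*} {l : Filter κ} {m : ℕ} {c : κ → Fin m → E} {e : Fin m → E}
    {u : κ → ℂ} {x : ℂ} (hc : Tendsto c l (𝓝 e)) (hu : Tendsto u l (𝓝 x)) :
    Tendsto (fun q => polyOfCoeff (c q) (u q)) l (𝓝 (polyOfCoeff e x)) :=
  tendsto_finsetSum _ fun k _ => (hu.pow _).smul (tendsto_pi_nhds.1 hc k)

variable {ι : Type*} [Fintype ι] [DecidableEq ι] {p : ι → ℂ} {b : ι → E →L[ℂ] E}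

/-- If `g` is a locally uniform limit of polynomials, then the Fuchsian equation can be solved
analytically after subtracting a polynomial of low degree. -/
theorem exists_isSolOn_sub_polyFun [FiniteDimensional ℂ E] {m : ℕ}
    (hm : Fintype.card ι = m + 1) (hp : Function.Injective p)
    (hinv : ∀ (k : ℕ) (j : ι), Function.Injective fun v : E => (k : ℂ) • v + b j v)
    (hinf : ∀ k : ℕ, Function.Bijective fun v : E => (k : ℂ) • v + ∑ j, b j v)
    {D : Set ℂ} (hD : IsOpen D) (hDc : IsPreconnected D) (hpD : ∀ j, p j ∈ D)
    {g : ℂ → E} (hg : ContinuousOn g D) {G : ℕ → ℂ → E} (hG : ∀ n, ∃ d, G n ∈ polyFun E d)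
    (hlim : TendstoLocallyUniformlyOn G g atTop D) :
    ∃ φ ∈ polyFun E m, ∃ y, IsSolOn p b (fun x => g x - φ x) D y := by
  have : Nonempty ι := Fintype.card_pos_iff.1 (by omega)
  have hproper : ProperSpace E := FiniteDimensional.proper ℂ E
  have hdiv : ∀ n, ∃ (y : ℂ → E) (c : Fin m → E), Differentiable ℂ y ∧
      ∀ x, fuchsianOp p b y x = G n x - polyOfCoeff c x := by
    intro n
    obtain ⟨d, hd⟩ := hG n
    obtain ⟨y, φ, hy, hφ, heq⟩ := exists_fuchsianOp_add_eq_of_mem_polyFun (p := p) (b := b) hm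
      (fun k => (hinf k).2) hd
    obtain ⟨c, rfl⟩ := mem_polyFun_iff_exists_polyOfCoeff.1 hφ
    exact ⟨y, c, hy, fun x => eq_sub_of_add_eq (heq x)⟩
  choose y c hy heq using hdiv
  -- projective normalisation of the pair `(g, φ)`
  set t : ℕ → ℝ := fun n => (1 + ‖c n‖)⁻¹ with ht
  have htpos : ∀ n, 0 < 1 + ‖c n‖ := fun n => by positivity
  have hmem : ∀ n, (t n, (t n : ℂ) • c n) ∈ Icc (0 : ℝ) 1 ×ˢ closedBall (0 : Fin m → E) 1 := by
    intro n
    refine ⟨⟨(inv_pos.2 (htpos n)).le, inv_le_one_of_one_le₀ (by linarith [norm_nonneg (c n)])⟩, ?_⟩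
    rw [mem_closedBall_zero_iff, norm_smul, Complex.norm_real, ht,
      Real.norm_of_nonneg (inv_pos.2 (htpos n)).le, inv_mul_le_iff₀ (htpos n)]
    linarith
  have hnorm : ∀ n, t n + ‖(t n : ℂ) • c n‖ = 1 := by
    intro n
    rw [norm_smul, Complex.norm_real, ht, Real.norm_of_nonneg (inv_pos.2 (htpos n)).le]
    have := (htpos n).ne'
    field_simp
  obtain ⟨⟨τ, e⟩, -, s, hs, hconv⟩ :=
    (isCompact_Icc.prod (isCompact_closedBall (0 : Fin m → E) 1)).tendsto_subseq hmem
  have hconv1 : Tendsto (fun n => t (s n)) atTop (𝓝 τ) :=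
    (continuous_fst.tendsto _).comp hconv
  have hconv2 : Tendsto (fun n => (t (s n) : ℂ) • c (s n)) atTop (𝓝 e) :=
    (continuous_snd.tendsto _).comp hconv
  have hτe : τ + ‖e‖ = 1 := tendsto_nhds_unique (hconv1.add hconv2.norm)
    (tendsto_const_nhds.congr fun n => (hnorm (s n)).symm)
  have hpe : Continuous (polyOfCoeff e) := continuous_iff_continuousAt.2 fun x =>
    tendsto_polyOfCoeff tendsto_const_nhds tendsto_id
  have hlim' : TendstoLocallyUniformlyOn
      (fun n => fuchsianOp p b fun x => (t (s n) : ℂ) • y (s n) x)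
      (fun x => (τ : ℂ) • g x - polyOfCoeff e x) atTop D := by
    rw [tendstoLocallyUniformlyOn_iff_forall_tendsto_nhds
      (f := fun x => (τ : ℂ) • g x - polyOfCoeff e x)
      ((hg.const_smul (τ : ℂ)).sub hpe.continuousOn)]
    rw [tendstoLocallyUniformlyOn_iff_forall_tendsto_nhds hg] at hlim
    intro x hx
    have h1 : Tendsto (fun q : ℕ × ℂ => G (s q.1) q.2) (atTop ×ˢ 𝓝[D] x) (𝓝 (g x)) :=
      (hlim x hx).comp ((hs.tendsto_atTop.comp tendsto_fst).prodMk tendsto_snd)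
    have h2 : Tendsto (fun q : ℕ × ℂ => (t (s q.1) : ℂ)) (atTop ×ˢ 𝓝[D] x) (𝓝 (τ : ℂ)) :=
      (Complex.continuous_ofReal.tendsto _).comp (hconv1.comp tendsto_fst)
    have h3 : Tendsto (fun q : ℕ × ℂ => polyOfCoeff ((t (s q.1) : ℂ) • c (s q.1)) q.2)
        (atTop ×ˢ 𝓝[D] x) (𝓝 (polyOfCoeff e x)) :=
      tendsto_polyOfCoeff (hconv2.comp tendsto_fst) (tendsto_snd.mono_right nhdsWithin_le_nhds)
    refine ((h2.smul h1).sub h3).congr fun q => ?_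
    rw [fuchsianOp_const_smul _ (hy _ _), heq, smul_sub, polyOfCoeff_smul]
  obtain ⟨z, hz, hzeq⟩ := exists_fuchsianOp_eq_of_tendsto hp hinv hD hDc hpD
    (fun n => ((hy (s n)).const_smul (t (s n) : ℂ)).differentiableOn) hlim'
  -- If the weight of `g` vanished in the limit, the polynomial with coefficients `-e` would lie in
  -- the range of the operator; uniqueness gives `e = 0`, against `τ + ‖e‖ = 1`.
  have hτ : τ ≠ 0 := by
    rintro rfl
    have h0 := eq_zero_of_isSolOn_polyFun (p := p) (b := b) hm hp hinv (fun k => (hinf k).1)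
      hD hDc hpD ((polyFun E m).neg_mem (mem_polyFun_iff_exists_polyOfCoeff.2 ⟨e, rfl⟩))
      (y := z) ⟨hz, fun x hx => by simp [hzeq x hx]⟩
    have he : e = 0 := eq_zero_of_polyOfCoeff_eq_zero fun x => by
      simpa using congrFun h0 x
    simp [he] at hτe
  have hτ' : (τ : ℂ) ≠ 0 := by exact_mod_cast hτ
  refine ⟨polyOfCoeff ((τ : ℂ)⁻¹ • e), mem_polyFun_iff_exists_polyOfCoeff.2 ⟨_, rfl⟩,
    fun x => (τ : ℂ)⁻¹ • z x, hz.const_smul _, fun x hx => ?_⟩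
  rw [fuchsianOp_const_smul _ ((hz x hx).differentiableAt (hD.mem_nhds hx)), hzeq x hx, smul_sub,
    inv_smul_smul₀ hτ', ← polyOfCoeff_smul]

end Existence

/-! ### Vector polynomials and vector-valued Runge approximation. -/

section VectorPolynomials

variable {N : ℕ}

theorem vecPolyEval_mem_polyFun {n : ℕ} {φ : Fin N → ℂ[X]} (hφ : ∀ i, (φ i).natDegree < n) :
    vecPolyEval φ ∈ polyFun (Fin N → ℂ) n := by
  have h1 : vecPolyEval φ = ∑ i, fun x => (φ i).eval x • (Pi.single i 1 : Fin N → ℂ) := by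
    funext x k
    simp [vecPolyEval, Finset.sum_apply, Pi.single_apply]
  rw [h1]
  refine Submodule.sum_mem _ fun i _ => eval_smul_mem_polyFun ?_ _
  rw [Polynomial.mem_degreeLT]
  exact (Polynomial.degree_le_natDegree).trans_lt (by exact_mod_cast hφ i)

theorem exists_vecPolyEval_eq {S : ℕ} {f : ℂ → Fin N → ℂ} (hf : f ∈ polyFun (Fin N → ℂ) (S + 1)) :
    ∃ φ : Fin N → ℂ[X], (∀ i, (φ i).natDegree ≤ S) ∧ vecPolyEval φ = f := by
  obtain ⟨c, hc⟩ := hf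
  refine ⟨fun i => ∑ k ∈ Finset.range (S + 1), C (c k i) * X ^ k, fun i => ?_, ?_⟩
  · refine Polynomial.natDegree_sum_le_of_forall_le _ _ fun k hk => ?_
    exact (Polynomial.natDegree_C_mul_X_pow_le _ _).trans
      (Nat.lt_succ_iff.1 (Finset.mem_range.1 hk))
  · funext x i
    simp only [vecPolyEval, hc, Polynomial.eval_finsetSum, eval_mul, eval_C, eval_pow, eval_X,
      Finset.sum_apply, Pi.smul_apply, smul_eq_mul, mul_comm]

/-- Runge approximation of vector-valued functions by a sequence of polynomials. -/
theorem exists_seq_polyFun_tendstoLocallyUniformlyOn {D : Set ℂ} (hD : IsOpen D)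
    (hDsc : IsSimplyConnected D) {g : ℂ → Fin N → ℂ} (hg : DifferentiableOn ℂ g D) :
    ∃ G : ℕ → ℂ → Fin N → ℂ, (∀ n, ∃ d, G n ∈ polyFun (Fin N → ℂ) d) ∧
      TendstoLocallyUniformlyOn G g atTop D := by
  have hlc : LocallyCompactSpace D := hD.locallyCompactSpace
  let K := CompactExhaustion.choice D
  have hex : ∀ n : ℕ, ∃ q : Fin N → ℂ[X], ∀ x ∈ ((↑) : D → ℂ) '' K n,
      dist (g x) (vecPolyEval q x) < 1 / ((n : ℝ) + 1) := by
    intro n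
    have hKc : IsCompact (((↑) : D → ℂ) '' K n) := (K.isCompact n).image continuous_subtype_val
    have hKD : ((↑) : D → ℂ) '' K n ⊆ D := by
      rintro _ ⟨x, -, rfl⟩
      exact x.2
    have hpos : (0 : ℝ) < 1 / ((n : ℝ) + 1) := by positivity
    choose q hq using fun i : Fin N => exists_polynomial_near hD hDsc
      (f := fun x => g x i) (differentiableOn_pi.1 hg i) hKc hKD hpos
    refine ⟨q, fun x hx => ?_⟩
    rw [dist_pi_lt_iff hpos]
    intro i
    rw [dist_eq_norm]
    exact hq i x hx
  choose q hq using hex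
  refine ⟨fun n => vecPolyEval (q n), fun n => ?_, ?_⟩
  · refine ⟨∑ i, (q n i).natDegree + 1, vecPolyEval_mem_polyFun fun i => ?_⟩
    exact Nat.lt_succ_of_le (Finset.single_le_sum (f := fun i => (q n i).natDegree)
      (fun _ _ => Nat.zero_le _) (Finset.mem_univ i))
  · rw [tendstoLocallyUniformlyOn_iff_forall_isCompact hD]
    intro L hLD hL
    have hL' : IsCompact (((↑) : D → ℂ) ⁻¹' L) :=
      Topology.IsInducing.subtypeVal.isCompact_preimage' hL (by simpa using hLD)
    obtain ⟨n₀, hn₀⟩ := K.exists_superset_of_isCompact hL'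
    rw [Metric.tendstoUniformlyOn_iff]
    intro ε hε
    have hlim := tendsto_one_div_add_atTop_nhds_zero_nat (𝕜 := ℝ)
    filter_upwards [hlim.eventually (gt_mem_nhds hε), eventually_ge_atTop n₀] with n hn hnn x hx
    refine (hq n x ⟨⟨x, hLD hx⟩, K.subset hnn (hn₀ hx), rfl⟩).trans hn

end VectorPolynomials

/-! ### Translation between the matrix equation and the operator. -/

section Main

variable {S N : ℕ} {p : Fin (S + 2) → ℂ} {B : Fin (S + 2) → Matrix (Fin N) (Fin N) ℂ}

/-- The residue matrices as continuous linear maps. -/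
noncomputable def residueCLM (B : Fin (S + 2) → Matrix (Fin N) (Fin N) ℂ) (j : Fin (S + 2)) :
    (Fin N → ℂ) →L[ℂ] (Fin N → ℂ) :=
  LinearMap.toContinuousLinearMap (B j).mulVecLin

theorem residueCLM_apply (j : Fin (S + 2)) (v : Fin N → ℂ) :
    residueCLM B j v = (B j).mulVec v := rfl

theorem fuchsianOp_residueCLM {y : ℂ → Fin N → ℂ} {x : ℂ} (hx : ∀ j, x ≠ p j) :
    fuchsianOp p (residueCLM B) y x =
      fuchsianDenom p x • (deriv y x + (fuchsianMatrix p B x).mulVec (y x)) := by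
  have hne : ∀ j, x - p j ≠ 0 := fun j => sub_ne_zero.2 (hx j)
  have hQ : fuchsianDenom p x ≠ 0 := Finset.prod_ne_zero_iff.2 fun j _ => hne j
  have h1 : (fuchsianMatrix p B x).mulVec (y x) =
      (fuchsianDenom p x)⁻¹ • fuchsianCoeff p (residueCLM B) x (y x) := by
    rw [fuchsianDenom, inv_prod_smul_fuchsianCoeff_apply hne, fuchsianMatrix, Matrix.sum_mulVec]
    exact Finset.sum_congr rfl fun j _ => by rw [Matrix.smul_mulVec, residueCLM_apply]
  rw [h1, smul_add, smul_inv_smul₀ hQ]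
  rfl

/-- At the points `p j` only the cleared equation makes sense; it holds there by continuity, the
singular points being isolated. -/
theorem isAnalyticFuchsianSolution_iff {D : Set ℂ} (hD : IsOpen D) {g y : ℂ → Fin N → ℂ}
    (hg : ContinuousOn g D) :
    IsAnalyticFuchsianSolution p B D g y ↔ IsSolOn p (residueCLM B) g D y := by
  have hQ : ∀ x, (∀ j, x ≠ p j) → fuchsianDenom p x ≠ 0 := fun x hx =>
    Finset.prod_ne_zero_iff.2 fun j _ => sub_ne_zero.2 (hx j)
  rw [IsAnalyticFuchsianSolution, Complex.analyticOnNhd_iff_differentiableOn hD]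
  refine and_congr_right fun hy => ⟨fun h x hx => ?_, fun h x hx hxp => ?_⟩
  · have hreg : ∀ z ∈ D, (∀ j, z ≠ p j) → fuchsianOp p (residueCLM B) y z = g z :=
      fun z hz hzp => by rw [fuchsianOp_residueCLM hzp, h z hz hzp, smul_inv_smul₀ (hQ z hzp)]
    have hev : ∀ᶠ z in 𝓝[≠] x, fuchsianOp p (residueCLM B) y z = g z := by
      have hfin : ∀ᶠ z in 𝓝[≠] x, ∀ j, z ≠ p j := by
        refine eventually_all.2 fun j => ?_
        by_cases hxj : x = p j
        · subst hxj
          exact self_mem_nhdsWithin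
        · exact eventually_nhdsWithin_of_eventually_nhds (eventually_ne_nhds hxj)
      filter_upwards [hfin, mem_nhdsWithin_of_mem_nhds (hD.mem_nhds hx)] with z hz hzD
      exact hreg z hzD hz
    exact tendsto_nhds_unique_of_eventuallyEq
      ((((differentiableOn_fuchsianOp hD hy).continuousOn.continuousAt (hD.mem_nhds hx)).tendsto
        ).mono_left nhdsWithin_le_nhds)
      (((hg.continuousAt (hD.mem_nhds hx)).tendsto).mono_left nhdsWithin_le_nhds) hev
  · rw [← h x hx, fuchsianOp_residueCLM hxp, inv_smul_smul₀ (hQ x hxp)]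

end Main

end FuchsianSystems

theorem lemma3 (S N : ℕ) (p : Fin (S + 2) → ℂ) (hp : Function.Injective p)
    (B : Fin (S + 2) → Matrix (Fin N) (Fin N) ℂ)
    (hB : ∀ (k : ℕ) (j : Fin (S + 2)),
      IsUnit ((k : ℂ) • (1 : Matrix (Fin N) (Fin N) ℂ) + B j))
    (hBinf : ∀ k : ℕ, IsUnit ((k : ℂ) • (1 : Matrix (Fin N) (Fin N) ℂ) + ∑ j, B j))
    (D : Set ℂ) (hDo : IsOpen D) (hDsc : IsSimplyConnected D) (hpD : ∀ j, p j ∈ D)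
    (g : ℂ → Fin N → ℂ) (hg : AnalyticOnNhd ℂ g D) :
    ∃! φ : Fin N → ℂ[X], (∀ i, (φ i).natDegree ≤ S) ∧
      ∃ y : ℂ → Fin N → ℂ,
        IsAnalyticFuchsianSolution p B D (fun x => g x - vecPolyEval φ x) y := by
  have hm : Fintype.card (Fin (S + 2)) = (S + 1) + 1 := by simp
  have hDc : IsPreconnected D := hDsc.isPathConnected.isConnected.isPreconnected
  have hinv : ∀ (k : ℕ) (j : Fin (S + 2)), Function.Injective
      fun v : Fin N → ℂ => (k : ℂ) • v + residueCLM B j v := fun k j => by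
    have h1 := Matrix.mulVec_injective_of_isUnit (hB k j)
    have h2 : ((k : ℂ) • (1 : Matrix (Fin N) (Fin N) ℂ) + B j).mulVec =
        fun v : Fin N → ℂ => (k : ℂ) • v + residueCLM B j v := by
      funext v
      simp only [Matrix.add_mulVec, Matrix.smul_mulVec, Matrix.one_mulVec, residueCLM_apply]
    rwa [h2] at h1
  have hinf : ∀ k : ℕ, Function.Bijective
      fun v : Fin N → ℂ => (k : ℂ) • v + ∑ j, residueCLM B j v := fun k => by
    have h1 := Matrix.mulVec_injective_of_isUnit (hBinf k)
    have h2 := Matrix.mulVec_surjective_iff_isUnit.2 (hBinf k)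
    have h3 : ((k : ℂ) • (1 : Matrix (Fin N) (Fin N) ℂ) + ∑ j, B j).mulVec =
        fun v : Fin N → ℂ => (k : ℂ) • v + ∑ j, residueCLM B j v := by
      funext v
      simp only [Matrix.add_mulVec, Matrix.smul_mulVec, Matrix.one_mulVec, Matrix.sum_mulVec,
        residueCLM_apply]
    rw [h3] at h1 h2
    exact ⟨h1, h2⟩
  have hgd : DifferentiableOn ℂ g D := hg.differentiableOn
  have hcont : ∀ φ : Fin N → ℂ[X], (∀ i, (φ i).natDegree ≤ S) →
      ContinuousOn (fun x => g x - vecPolyEval φ x) D := fun φ hφ =>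
    hgd.continuousOn.sub (differentiable_of_mem_polyFun
      (vecPolyEval_mem_polyFun (n := S + 1) fun i => Nat.lt_succ_of_le (hφ i))).continuous.continuousOn
  obtain ⟨G, hG, hlim⟩ := exists_seq_polyFun_tendstoLocallyUniformlyOn hDo hDsc hgd
  obtain ⟨f, hf, y, hy⟩ := exists_isSolOn_sub_polyFun hm hp hinv hinf hDo hDc hpD
    hgd.continuousOn hG hlim
  obtain ⟨φ, hφ, rfl⟩ := exists_vecPolyEval_eq hf
  refine ⟨φ, ⟨hφ, y, (isAnalyticFuchsianSolution_iff hDo (hcont φ hφ)).2 hy⟩, ?_⟩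
  rintro ψ ⟨hψ, z, hz⟩
  rw [isAnalyticFuchsianSolution_iff hDo (hcont ψ hψ)] at hz
  have hmem : ∀ χ : Fin N → ℂ[X], (∀ i, (χ i).natDegree ≤ S) →
      vecPolyEval χ ∈ polyFun (Fin N → ℂ) (S + 1) := fun χ hχ =>
    vecPolyEval_mem_polyFun fun i => Nat.lt_succ_of_le (hχ i)
  -- Subtracting the two equations cancels `g`: the operator sends `y - z` to `ψ - φ`.
  have h0 := eq_zero_of_isSolOn_polyFun hm hp hinv (fun k => (hinf k).1) hDo hDc hpD
    (sub_mem (hmem ψ hψ) (hmem φ hφ)) (y := fun x => y x - z x)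
    ⟨hy.1.sub hz.1, fun x hx => by
      rw [fuchsianOp_sub ((hy.1 x hx).differentiableAt (hDo.mem_nhds hx))
        ((hz.1 x hx).differentiableAt (hDo.mem_nhds hx)), hy.2 x hx, hz.2 x hx]
      simp⟩
  funext i
  refine Polynomial.funext fun x => ?_
  have := congrFun (congrFun h0 x) i
  simpa [vecPolyEval, sub_eq_zero] using this
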